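/- Equip the set $\mathcal{A}(d,1)$ of all lines in $\mathbb{R}^d$ with the metric $d(V+a,V'+a')=\|P_V-P_{V'}\|+|a-a'|$, where a line is written uniquely as $V+a$ with $V$ a one-dimensional linear subspace and $a\in V^\perp$, $P_V$ is the orthogonal projection onto $V$, and $\|\cdot\|$ is the operator norm. For a non-empty set $X$ in $\mathbb{R}^d$ or in $\mathcal{A}(d,1)$, the packing dimension is $$\dim_{\mathrm P}X=\inf\Big\{\sup_i\overline{\dim}_{\mathrm B}X_i : X\subseteq\bigcup_{i} X_i\Big\},$$ the infimum being over countable covers of $X$ by bounded sets $X_i$, where $\overline{\dim}_{\mathrm B}Y=\limsup_{\delta\to0}\frac{\log N_\delta(Y)}{-\log\delta}$ is the upper box dimension and $N_\delta(Y)$ is the smallest number of sets of diameter at most $\delta$ needed to cover $Y$. Let $d\geq2$ be an integer, $s\in[0,1]$ and $t\in[0,2(d-1)]$. There exist a compact set $X\subseteq\mathbb{R}^d$ with $$\dim_{\mathrm P}X=\max\{s,t/2\}$$ and a non-empty collection of lines $\mathcal{L}\subseteq\mathcal{A}(d,1)$ of packing dimension $t$ such that, for all $L\in\mathcal{L}$,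 $L\cap X$ is a non-empty set of packing dimension at least $s$. -/

import Mathlib

open Set Filter Topology

noncomputable section

/-- `N_δ(X)`: the smallest number of sets of diameter at most `δ` needed to cover `X`
(`⊤` if no finite number suffices). -/
def coverCount {α : Type*} [PseudoMetricSpace α] (δ : ℝ) (X : Set α) : ℕ∞ :=
  ⨅ (n : ℕ) (_ : ∃ U : Fin n → Set α,
    (∀ i, Metric.ediam (U i) ≤ ENNReal.ofReal δ) ∧ X ⊆ ⋃ i, U i), (n : ℕ∞)

/-- Upper box dimension: `limsup_{δ → 0} log N_δ(X) / (- log δ)`, as an extended real. -/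
def upperBoxDim {α : Type*} [PseudoMetricSpace α] (X : Set α) : EReal :=
  limsup (fun δ : ℝ => ENNReal.log (coverCount δ X : ENNReal) / ((-Real.log δ : ℝ) : EReal))
    (𝓝[>] (0 : ℝ))

/-- Packing dimension: the infimum of `sup_i upperBoxDim (X_i)` over all countable covers of `X`
by bounded sets `X_i`. -/
def packingDim {α : Type*} [PseudoMetricSpace α] (X : Set α) : EReal :=
  ⨅ (Y : ℕ → Set α) (_ : (∀ i, Bornology.IsBounded (Y i)) ∧ X ⊆ ⋃ i, Y i),
    ⨆ i, upperBoxDim (Y i)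

/-- The affine Grassmannian `𝒜(d,1)`: all lines in `ℝ^d`. -/
def AffineLine (d : ℕ) : Type :=
  {L : AffineSubspace ℝ (EuclideanSpace ℝ (Fin d)) //
    (L : Set (EuclideanSpace ℝ (Fin d))).Nonempty ∧ Module.finrank ℝ L.direction = 1}

namespace AffineLine

variable {d : ℕ}

/-- The set of points on a line. -/
def points (L : AffineLine d) : Set (EuclideanSpace ℝ (Fin d)) :=
  (L.1 : Set (EuclideanSpace ℝ (Fin d)))

/-- The direction `V` of the line `L = V + a`. -/
def direction (L : AffineLine d) : Submodule ℝ (EuclideanSpace ℝ (Fin d)) :=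
  L.1.direction

instance instNonemptyCarrier (L : AffineLine d) : Nonempty L.1 := L.2.1.to_subtype

/-- The translation `a ∈ Vᗮ` of the line `L = V + a`: the foot of the perpendicular
from the origin. -/
def translation (L : AffineLine d) : EuclideanSpace ℝ (Fin d) :=
  (EuclideanGeometry.orthogonalProjection L.1 0 : EuclideanSpace ℝ (Fin d))

theorem translation_mem (L : AffineLine d) : L.translation ∈ L.1 :=
  EuclideanGeometry.orthogonalProjection_mem _

theorem translation_mem_orthogonal (L : AffineLine d) : L.translation ∈ L.directionᗮ := by
  have h := EuclideanGeometry.orthogonalProjection_vsub_mem_direction_orthogonal L.1 0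
  simpa [translation, direction] using h

theorem ext_of_direction_translation {L M : AffineLine d} (h : L.direction = M.direction)
    (h' : L.translation = M.translation) : L = M := by
  apply Subtype.ext
  refine AffineSubspace.ext_of_direction_eq h ⟨L.translation, L.translation_mem, ?_⟩
  rw [h']
  exact M.translation_mem

/-- The metric `d(V + a, V' + a') = ‖P_V - P_V'‖ + |a - a'|`, where `a ∈ Vᗮ`, `a' ∈ V'ᗮ`. -/
instance instMetricSpace : MetricSpace (AffineLine d) where
  dist L M := ‖L.direction.starProjection - M.direction.starProjection‖
    + ‖L.translation - M.translation‖
  dist_self L := by simp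
  dist_comm L M := by
    rw [norm_sub_rev, norm_sub_rev L.translation]
  dist_triangle L M N := by
    have h1 := norm_sub_le_norm_sub_add_norm_sub L.direction.starProjection
      M.direction.starProjection N.direction.starProjection
    have h2 := norm_sub_le_norm_sub_add_norm_sub L.translation M.translation N.translation
    linarith
  eq_of_dist_eq_zero {L M} h := by
    have h1 := norm_nonneg (L.direction.starProjection - M.direction.starProjection)
    have h2 := norm_nonneg (L.translation - M.translation)
    have h3 : ‖L.direction.starProjection - M.direction.starProjection‖ = 0 := by linarith
    have h4 : ‖L.translation - M.translation‖ = 0 := by linarith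
    rw [norm_sub_eq_zero_iff] at h3 h4
    refine ext_of_direction_translation ?_ h4
    rw [← Submodule.range_starProjection L.direction, h3, Submodule.range_starProjection]

end AffineLine

end

/-!
Write `d = m + 1` and `t = 2 m α`, so `α ∈ [0, 1]`. Choose Cantor sets `A, F ⊆ [0, 1]` of packing
dimension `α` and `s`, let `𝓛` be the set of lines through `(0, a)` and `(1, b)` with `a, b ∈ A ^ m`,
and let `X` be the set of points of these lines whose first coordinate lies in `F`. Each line then
meets `X` in an affine copy of `F`, and `(a, b) ↦ line` is bi-Lipschitz (`dist_lineThrough_le`,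
`exists_abs_sub_le_dist_lineThrough`), so that `𝓛` has the packing dimension `2 m α = t` of
`A ^ m × A ^ m`. Also `X` contains a copy of `F` and, in the slice `y = 0`, a copy of `A ^ m`.

The point is the upper bound `max s (m α)` for the dimension of `X` (`upperBoxDim_lineUnion_le`).
Packing dimension only sees a sequence of scales, so `A` and `F` can be built such that they branch
at very different scales: a range of scales where `A` branches, one where nothing happens, one where
`F` branches, one where nothing happens, and so on, each much longer than the preceding one
(`exists_idle_range`). Look at `X` at a scale `δ`. If `A` has not branched since a scale much larger
than `δ`, there are few pairs `(a, b)`, and the points of `F` are counted: about `δ ^ (-s)`. If `F`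
has not branched since a scale much larger than `δ`, there are few values of `y`, and they are
dyadic rationals of small denominator. Now `A` is a digit set for large radices, whose digits run
through an initial segment of the possible values, and so `(1 - y) A + y A` is, up to the small
denominator, contained in a digit set with digits bounded by a small multiple of those of `A`. It
has about as many points as `A` itself, and `X` is covered by about `δ ^ (-m α)` sets
(`coveredBy_lineUnion_of_idle`).

In the construction, the `j`-th digit stands for the binary places from `j ^ 2` to `(j + 1) ^ 2`,
so that a number with `n` digits is known up to `2 ^ (-n ^ 2)`; these scales suffice for computing
box dimensions (`upperBoxDim_le_of_square_scales`). The lower bounds for packing dimensions come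
from Baire's theorem (`le_packingDim_pi_digitSet`) and from maps that do not contract distances
(`packingDim_le_packingDim_image`).
-/

/-! ### Covering numbers and upper box dimension -/

/-- `X` is covered by `n` sets of diameter at most `δ`; `coverCount δ X` is the least such `n`. -/
def CoveredBy {α : Type*} [PseudoMetricSpace α] (δ : ℝ) (n : ℕ) (X : Set α) : Prop :=
  ∃ U : Fin n → Set α, (∀ i, Metric.ediam (U i) ≤ ENNReal.ofReal δ) ∧ X ⊆ ⋃ i, U i

section Cover

variable {α β : Type*} [PseudoMetricSpace α] [PseudoMetricSpace β]

theorem dist_le_of_ediam_le {U : Set α} {δ : ℝ} (hδ : 0 ≤ δ)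
    (hU : Metric.ediam U ≤ ENNReal.ofReal δ) {x y : α} (hx : x ∈ U) (hy : y ∈ U) :
    dist x y ≤ δ := by
  have h := (Metric.edist_le_ediam_of_mem hx hy).trans hU
  rw [edist_dist] at h
  exact (ENNReal.ofReal_le_ofReal_iff hδ).1 h

theorem ediam_le_of_dist_le {U : Set α} {δ : ℝ} (h : ∀ x ∈ U, ∀ y ∈ U, dist x y ≤ δ) :
    Metric.ediam U ≤ ENNReal.ofReal δ := by
  refine Metric.ediam_le fun x hx y hy => ?_
  rw [edist_dist]
  exact ENNReal.ofReal_le_ofReal (h x hx y hy)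

theorem CoveredBy.coverCount_le {δ : ℝ} {n : ℕ} {X : Set α} (h : CoveredBy δ n X) :
    coverCount δ X ≤ n :=
  iInf₂_le n h

theorem exists_coveredBy_eq_coverCount {δ : ℝ} {X : Set α} (h : coverCount δ X ≠ ⊤) :
    ∃ n : ℕ, CoveredBy δ n X ∧ coverCount δ X = n := by
  have e : coverCount δ X = sInf ((fun n : ℕ => (n : ℕ∞)) '' {n | CoveredBy δ n X}) := by
    rw [sInf_image]; rfl
  have hne : ((fun n : ℕ => (n : ℕ∞)) '' {n | CoveredBy δ n X}).Nonempty := by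
    by_contra hemp
    rw [not_nonempty_iff_eq_empty] at hemp
    rw [hemp, sInf_empty] at e
    exact h e
  obtain ⟨n, hn, hn'⟩ := csInf_mem hne
  exact ⟨n, hn, by rw [e, ← hn']⟩

theorem CoveredBy.mono {δ δ' : ℝ} {n : ℕ} {X Y : Set α} (h : CoveredBy δ n X) (hδ : δ ≤ δ')
    (hY : Y ⊆ X) : CoveredBy δ' n Y := by
  obtain ⟨U, hU, hX⟩ := h
  exact ⟨U, fun i => (hU i).trans (ENNReal.ofReal_le_ofReal hδ), hY.trans hX⟩

theorem CoveredBy.image {δ K : ℝ} {n : ℕ} {A : Set α} {f : α → β} (h : CoveredBy δ n A)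
    (hδ : 0 ≤ δ) (hK : 0 ≤ K) (hf : ∀ x ∈ A, ∀ y ∈ A, dist (f x) (f y) ≤ K * dist x y) :
    CoveredBy (K * δ) n (f '' A) := by
  obtain ⟨U, hU, hX⟩ := h
  refine ⟨fun i => f '' (U i ∩ A), fun i => ediam_le_of_dist_le ?_, ?_⟩
  · rintro _ ⟨x, hx, rfl⟩ _ ⟨y, hy, rfl⟩
    exact (hf x hx.2 y hy.2).trans
      (mul_le_mul_of_nonneg_left (dist_le_of_ediam_le hδ (hU i) hx.1 hy.1) hK)
  · rintro _ ⟨x, hx, rfl⟩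
    obtain ⟨i, hi⟩ := mem_iUnion.1 (hX hx)
    exact mem_iUnion.2 ⟨i, x, ⟨hi, hx⟩, rfl⟩

theorem coveredBy_of_net {I : Type*} [Fintype I] {r : ℝ} {X : Set α} (g : I → α)
    (h : ∀ x ∈ X, ∃ i, dist x (g i) ≤ r) : CoveredBy (2 * r) (Fintype.card I) X := by
  refine ⟨fun i => Metric.closedBall (g ((Fintype.equivFin I).symm i)) r,
    fun i => ediam_le_of_dist_le ?_, ?_⟩
  · intro x hx y hy
    have := dist_triangle_right x y (g ((Fintype.equivFin I).symm i))
    rw [Metric.mem_closedBall] at hx hy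
    linarith
  · intro x hx
    obtain ⟨i, hi⟩ := h x hx
    exact mem_iUnion.2 ⟨Fintype.equivFin I i, by simpa using hi⟩

/-- A `δ`-separated family has at most as many members as any cover by sets of diameter `≤ δ`,
even if the family is only in the closure of the covered set. -/
theorem CoveredBy.card_le_of_separated {I : Type*} [Fintype I] {δ : ℝ} {n : ℕ} {X : Set α}
    (h : CoveredBy δ n X) (hδ : 0 ≤ δ) (g : I → α) (hg : ∀ i, g i ∈ closure X)
    (hsep : ∀ i j, i ≠ j → δ < dist (g i) (g j)) : Fintype.card I ≤ n := by
  obtain ⟨U, hU, hX⟩ := h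
  have hcl : closure X ⊆ ⋃ i, closure (U i) := by
    rw [← closure_iUnion_of_finite]
    exact closure_mono hX
  choose k hk using fun i => mem_iUnion.1 (hcl (hg i))
  have hinj : Function.Injective k := by
    intro i j hij
    by_contra hne
    have h1 := hk j
    rw [← hij] at h1
    exact absurd (dist_le_of_ediam_le hδ ((Metric.ediam_closure _).le.trans (hU (k i))) (hk i) h1)
      (not_le.2 (hsep i j hne))
  simpa using Fintype.card_le_of_injective k hinj

theorem log_natCast_le_iff {n : ℕ} {r : ℝ} :
    ENNReal.log (n : ENNReal) ≤ (r : EReal) ↔ (n : ℝ) ≤ Real.exp r := by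
  have e : (r : EReal) = ENNReal.log (ENNReal.ofReal (Real.exp r)) := by
    rw [ENNReal.log_ofReal_of_pos (Real.exp_pos r), Real.log_exp]
  rw [e, ENNReal.log_le_log_iff, ← ENNReal.ofReal_natCast,
    ENNReal.ofReal_le_ofReal_iff (Real.exp_pos r).le]

theorem exp_mul_neg_log {δ : ℝ} (hδ : 0 < δ) (c : ℝ) : Real.exp (c * -Real.log δ) = δ ^ (-c) := by
  rw [Real.rpow_def_of_pos hδ]
  congr 1
  ring

theorem eventually_coveredBy_of_upperBoxDim_lt {X : Set α} {c : ℝ} (h : upperBoxDim X < c) :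
    ∀ᶠ δ in 𝓝[>] (0 : ℝ), ∃ n : ℕ, CoveredBy δ n X ∧ (n : ℝ) ≤ δ ^ (-c) := by
  have h1 := eventually_lt_of_limsup_lt h
  filter_upwards [h1, Ioo_mem_nhdsGT (zero_lt_one' ℝ)] with δ hδ hδ1
  have hlog : 0 < -Real.log δ := neg_pos.2 (Real.log_neg hδ1.1 hδ1.2)
  rw [EReal.div_lt_iff (by exact_mod_cast hlog) (EReal.coe_ne_top _), ← EReal.coe_mul] at hδ
  have hfin : coverCount δ X ≠ ⊤ := by
    intro htop
    rw [htop] at hδ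
    simp at hδ
  obtain ⟨n, hn, hcount⟩ := exists_coveredBy_eq_coverCount hfin
  rw [hcount] at hδ
  refine ⟨n, hn, ?_⟩
  rw [← exp_mul_neg_log hδ1.1]
  exact log_natCast_le_iff.1 (by simpa using hδ.le)

theorem upperBoxDim_le_of_eventually_coveredBy {X : Set α} {c : ℝ}
    (h : ∀ᶠ δ in 𝓝[>] (0 : ℝ), ∃ n : ℕ, CoveredBy δ n X ∧ (n : ℝ) ≤ δ ^ (-c)) :
    upperBoxDim X ≤ c := by
  refine limsup_le_of_le (by isBoundedDefault) ?_
  filter_upwards [h, Ioo_mem_nhdsGT (zero_lt_one' ℝ)] with δ hδ hδ1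
  have hlog : 0 < -Real.log δ := neg_pos.2 (Real.log_neg hδ1.1 hδ1.2)
  obtain ⟨n, hn, hle⟩ := hδ
  rw [EReal.div_le_iff_le_mul (by exact_mod_cast hlog) (EReal.coe_ne_top _), ← EReal.coe_mul]
  rw [← exp_mul_neg_log hδ1.1, mul_comm, ← log_natCast_le_iff] at hle
  refine le_trans (ENNReal.log_monotone ?_) hle
  have := hn.coverCount_le
  calc ((coverCount δ X : ℕ∞) : ENNReal) ≤ ((n : ℕ∞) : ENNReal) := by exact_mod_cast this
    _ = n := by simp

theorem eventually_mul_rpow_le_one (B : ℝ) {η : ℝ} (hη : 0 < η) :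
    ∀ᶠ δ in 𝓝[>] (0 : ℝ), B * δ ^ η ≤ 1 := by
  have h : Tendsto (fun δ : ℝ => B * δ ^ η) (𝓝 0) (𝓝 (B * 0 ^ η)) :=
    ((Real.continuousAt_rpow_const 0 η (Or.inr hη.le)).tendsto).const_mul B
  rw [Real.zero_rpow hη.ne', mul_zero] at h
  exact (h.mono_left nhdsWithin_le_nhds).eventually (eventually_le_nhds zero_lt_one)

theorem upperBoxDim_image_le {A : Set α} {f : α → β} {K : ℝ} (hK : 0 < K)
    (hf : ∀ x ∈ A, ∀ y ∈ A, dist (f x) (f y) ≤ K * dist x y) :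
    upperBoxDim (f '' A) ≤ upperBoxDim A := by
  refine EReal.le_of_forall_lt_iff_le.1 fun c hc => ?_
  obtain ⟨c₁, h1, h2⟩ := EReal.lt_iff_exists_real_btwn.1 hc
  have h2 : c₁ < c := by exact_mod_cast h2
  have hscale : Tendsto (fun δ : ℝ => δ / K) (𝓝[>] 0) (𝓝[>] 0) := by
    refine tendsto_nhdsWithin_iff.2 ⟨?_, ?_⟩
    · have : Tendsto (fun δ : ℝ => δ / K) (𝓝 0) (𝓝 (0 / K)) := tendsto_id.div_const K
      rw [zero_div] at this
      exact this.mono_left nhdsWithin_le_nhds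
    · filter_upwards [self_mem_nhdsWithin] with δ hδ
      exact div_pos hδ hK
  refine upperBoxDim_le_of_eventually_coveredBy ?_
  filter_upwards [hscale.eventually (eventually_coveredBy_of_upperBoxDim_lt h1),
    eventually_mul_rpow_le_one (K ^ c₁) (sub_pos.2 h2), self_mem_nhdsWithin] with δ hδ hδ1 hδ0
  obtain ⟨n, hn, hle⟩ := hδ
  have hδ0 : 0 < δ := hδ0
  refine ⟨n, ?_, hle.trans ?_⟩
  · have := hn.image (div_pos hδ0 hK).le hK.le hf
    rwa [mul_div_cancel₀ _ hK.ne'] at this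
  · have e1 : (δ / K) ^ (-c₁) = K ^ c₁ * δ ^ (c - c₁) * δ ^ (-c) := by
      rw [Real.div_rpow hδ0.le hK.le, Real.rpow_neg hK.le, mul_assoc, ← Real.rpow_add hδ0,
        div_inv_eq_mul, mul_comm]
      congr 2
      ring
    rw [e1]
    exact mul_le_of_le_one_left (Real.rpow_nonneg hδ0.le _) hδ1

/-- To bound the upper box dimension it suffices to look at the scales `2 ^ (-n ^ 2)`: the ratio of
two consecutive exponents tends to `1`. -/
theorem upperBoxDim_le_of_square_scales {X : Set α} {c C : ℝ} (hc : 0 ≤ c) (hC : 0 < C)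
    (h : ∀ ε : ℝ, 0 < ε → ∀ᶠ n : ℕ in atTop, ∃ N : ℕ,
      CoveredBy (C / 2 ^ (n ^ 2)) N X ∧ (N : ℝ) ≤ 2 ^ ((c + ε) * (n : ℝ) ^ 2)) :
    upperBoxDim X ≤ c := by
  refine EReal.le_of_forall_lt_iff_le.1 fun c' hc' => ?_
  have hcc : c < c' := by exact_mod_cast hc'
  obtain ⟨ε, hε, rfl⟩ : ∃ ε : ℝ, 0 < ε ∧ c' = c + 2 * ε := ⟨(c' - c) / 2, by linarith, by ring⟩
  refine upperBoxDim_le_of_eventually_coveredBy ?_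
  -- The scale `δ` is compared with the first scale `C * 2 ^ (-n ^ 2)` below it.
  have hn : Tendsto (fun δ : ℝ => ⌈√(Real.logb 2 C + -Real.logb 2 δ)⌉₊) (𝓝[>] 0) atTop := by
    refine tendsto_nat_ceil_atTop.comp (Real.tendsto_sqrt_atTop.comp ?_)
    refine tendsto_atTop_add_const_left _ _ (tendsto_neg_atBot_atTop.comp ?_)
    exact Real.tendsto_logb_nhdsGT_zero one_lt_two
  have hlarge : ∀ᶠ n : ℕ in atTop, (c + 2 * ε) * (2 + |Real.logb 2 C|) / ε ≤ n :=
    tendsto_natCast_atTop_atTop.eventually_ge_atTop _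
  filter_upwards [hn.eventually ((h ε hε).and (hlarge.and (eventually_ge_atTop 1))),
    self_mem_nhdsWithin] with δ ⟨⟨N, hcov, hN⟩, hbig, h1⟩ hδ
  have hδ : 0 < δ := hδ
  set ℓ := Real.logb 2 C + -Real.logb 2 δ with hℓ
  set n := ⌈√ℓ⌉₊ with hndef
  have hge : ℓ ≤ (n : ℝ) ^ 2 := by
    have := Nat.le_ceil (√ℓ)
    exact (Real.sqrt_le_left (by positivity)).1 this
  have hpos : 0 < √ℓ := by
    rw [← Nat.ceil_pos]
    exact h1
  have hlt : ((n : ℝ) - 1) ^ 2 ≤ ℓ := by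
    have := Nat.ceil_lt_add_one hpos.le
    have h1' : (1 : ℝ) ≤ n := by exact_mod_cast h1
    rw [← Real.sq_sqrt (Real.sqrt_pos.1 hpos).le]
    exact pow_le_pow_left₀ (by linarith) (by linarith) 2
  have hexp : (2 : ℝ) ^ ℓ = C / δ := by
    rw [hℓ, ← sub_eq_add_neg, Real.rpow_sub two_pos, Real.rpow_logb two_pos (by norm_num) hC,
      Real.rpow_logb two_pos (by norm_num) hδ]
  refine ⟨N, hcov.mono ?_ subset_rfl, hN.trans ?_⟩
  · have : C / δ ≤ 2 ^ (n ^ 2) := by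
      rw [← hexp, ← Real.rpow_natCast]
      refine Real.rpow_le_rpow_of_exponent_le one_le_two ?_
      push_cast
      exact hge
    rw [div_le_iff₀ (by positivity)]
    rw [div_le_iff₀ hδ] at this
    linarith
  · have e : δ ^ (-(c + 2 * ε)) = 2 ^ ((c + 2 * ε) * -Real.logb 2 δ) := by
      conv_lhs => rw [← Real.rpow_logb two_pos (by norm_num) hδ, ← Real.rpow_mul two_pos.le]
      congr 1
      ring
    rw [e]
    refine Real.rpow_le_rpow_of_exponent_le one_le_two ?_
    have h1' : (1 : ℝ) ≤ n := by exact_mod_cast h1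
    rw [div_le_iff₀ hε] at hbig
    have h2 : (n : ℝ) ^ 2 - 2 * n - |Real.logb 2 C| ≤ -Real.logb 2 δ := by
      have := le_abs_self (Real.logb 2 C)
      nlinarith
    have h3 : (c + 2 * ε) * ((n : ℝ) ^ 2 - 2 * n - |Real.logb 2 C|)
        ≤ (c + 2 * ε) * -Real.logb 2 δ := mul_le_mul_of_nonneg_left h2 (by linarith)
    have h4 : (c + 2 * ε) * (2 * n + |Real.logb 2 C|) ≤ ε * n * n := by
      calc (c + 2 * ε) * (2 * n + |Real.logb 2 C|)
          ≤ (c + 2 * ε) * ((2 + |Real.logb 2 C|) * n) := by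
            refine mul_le_mul_of_nonneg_left ?_ (by linarith)
            nlinarith [abs_nonneg (Real.logb 2 C)]
        _ = (c + 2 * ε) * (2 + |Real.logb 2 C|) * n := by ring
        _ ≤ n * ε * n := mul_le_mul_of_nonneg_right hbig (by linarith)
        _ = ε * n * n := by ring
    nlinarith

theorem upperBoxDim_mono {A B : Set α} (h : A ⊆ B) : upperBoxDim A ≤ upperBoxDim B := by
  refine EReal.le_of_forall_lt_iff_le.1 fun c hc => ?_
  refine upperBoxDim_le_of_eventually_coveredBy ?_
  filter_upwards [eventually_coveredBy_of_upperBoxDim_lt hc] with δ ⟨n, hn, hle⟩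
  exact ⟨n, hn.mono le_rfl h, hle⟩

/-! ### Packing dimension under maps -/

theorem packingDim_mono {A B : Set α} (h : A ⊆ B) : packingDim A ≤ packingDim B :=
  le_iInf₂ fun Y hY => iInf₂_le Y ⟨hY.1, h.trans hY.2⟩

theorem packingDim_le_upperBoxDim {A : Set α} (h : Bornology.IsBounded A) :
    packingDim A ≤ upperBoxDim A :=
  (iInf₂_le (fun _ : ℕ => A) ⟨fun _ => h, subset_iUnion (fun _ : ℕ => A) 0⟩).trans (by simp)

end Cover

/-- Maps which do not contract distances by more than a constant factor do not lower packing
dimension: covers of the image pull back to covers whose members are Lipschitz images. -/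
theorem packingDim_le_packingDim_image {α β : Type*} [MetricSpace α] [PseudoMetricSpace β]
    {A : Set α} {f : α → β} {K : ℝ} (hA : A.Nonempty) (hK : 0 < K)
    (hf : ∀ x ∈ A, ∀ y ∈ A, dist x y ≤ K * dist (f x) (f y)) :
    packingDim A ≤ packingDim (f '' A) := by
  have : Nonempty α := hA.to_type
  set g := Function.invFunOn f A with hg
  have hgf : ∀ x ∈ A, g (f x) = x := by
    intro x hx
    have h1 : g (f x) ∈ A := Function.invFunOn_mem ⟨x, hx, rfl⟩
    have h2 : f (g (f x)) = f x := Function.invFunOn_eq ⟨x, hx, rfl⟩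
    have h3 := hf _ h1 _ hx
    rw [h2, dist_self, mul_zero] at h3
    exact dist_le_zero.1 h3
  have hgl : ∀ x ∈ f '' A, ∀ y ∈ f '' A, dist (g x) (g y) ≤ K * dist x y := by
    rintro _ ⟨x, hx, rfl⟩ _ ⟨y, hy, rfl⟩
    rw [hgf x hx, hgf y hy]
    exact hf x hx y hy
  refine le_iInf₂ fun Y hY => ?_
  refine iInf₂_le_of_le (fun i => g '' (Y i ∩ f '' A)) ⟨fun i => ?_, fun x hx => ?_⟩ ?_
  · obtain ⟨C, hC⟩ := Metric.isBounded_iff.1 (hY.1 i)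
    refine Metric.isBounded_iff.2 ⟨K * C, ?_⟩
    rintro _ ⟨x, hx, rfl⟩ _ ⟨y, hy, rfl⟩
    exact (hgl x hx.2 y hy.2).trans (mul_le_mul_of_nonneg_left (hC hx.1 hy.1) hK.le)
  · obtain ⟨i, hi⟩ := mem_iUnion.1 (hY.2 (mem_image_of_mem f hx))
    exact mem_iUnion.2 ⟨i, f x, ⟨hi, x, hx, rfl⟩, hgf x hx⟩
  · refine iSup_mono fun i => ?_
    refine (upperBoxDim_image_le hK fun x hx y hy => hgl x hx.2 y hy.2).trans ?_
    exact upperBoxDim_mono inter_subset_left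

/-! ### Mixed-radix Cantor sets -/

/-- The `n`-th partial sum of the expansion with digits `x`, in which the `j`-th digit has place
value `2 ^ (-(j + 1) ^ 2)`. The block of binary places between `j ^ 2` and `(j + 1) ^ 2` is thus
treated as a single digit. -/
noncomputable def digitSum (n : ℕ) (x : ℕ → ℕ) : ℝ :=
  ∑ j ∈ Finset.range n, (x j : ℝ) / 2 ^ ((j + 1) ^ 2)

/-- The real number with the given digits. -/
noncomputable def digitVal (x : ℕ → ℕ) : ℝ := ∑' j, (x j : ℝ) / 2 ^ ((j + 1) ^ 2)

/-- `digitSum n x` multiplied by `2 ^ (n ^ 2)`. -/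
def digitNum (x : ℕ → ℕ) : ℕ → ℕ
  | 0 => 0
  | n + 1 => digitNum x n * 2 ^ (2 * n + 1) + x n

/-- The real numbers which have an expansion with digits `x j ≤ L j`. -/
def digitSet (L : ℕ → ℕ) : Set ℝ := digitVal '' {x | ∀ j, x j ≤ L j}

/-- The number of digit strings of length `n`. -/
def digitCount (L : ℕ → ℕ) (n : ℕ) : ℕ := ∏ j ∈ Finset.range n, (L j + 1)

theorem two_pow_succ_sq (n : ℕ) : (2 : ℝ) ^ ((n + 1) ^ 2) = 2 ^ (n ^ 2) * 2 ^ (2 * n + 1) := by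
  rw [← pow_add]
  congr 1
  ring

theorem digitSum_eq (n : ℕ) (x : ℕ → ℕ) : digitSum n x = digitNum x n / 2 ^ (n ^ 2) := by
  induction n with
  | zero => simp [digitSum, digitNum]
  | succ n ih =>
    have : digitSum (n + 1) x = digitSum n x + (x n : ℝ) / 2 ^ ((n + 1) ^ 2) :=
      Finset.sum_range_succ _ _
    rw [this, ih, two_pow_succ_sq, digitNum]
    push_cast
    field_simp

theorem digitNum_inj {x y : ℕ → ℕ} {n : ℕ} (hx : ∀ j < n, x j < 2 ^ (2 * j + 1))
    (hy : ∀ j < n, y j < 2 ^ (2 * j + 1)) (h : digitNum x n = digitNum y n) :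
    ∀ j < n, x j = y j := by
  induction n with
  | zero => simp
  | succ n ih =>
    simp only [digitNum] at h
    have hxn := hx n n.lt_succ_self
    have hyn := hy n n.lt_succ_self
    have hmod := congrArg (· % 2 ^ (2 * n + 1)) h
    have hdiv := congrArg (· / 2 ^ (2 * n + 1)) h
    simp only [Nat.mul_add_mod', Nat.mod_eq_of_lt hxn, Nat.mod_eq_of_lt hyn] at hmod
    have hpos : 0 < 2 ^ (2 * n + 1) := by positivity
    simp only [Nat.mul_comm _ (2 ^ (2 * n + 1)), Nat.mul_add_div hpos, Nat.div_eq_of_lt hxn,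
      Nat.div_eq_of_lt hyn, add_zero] at hdiv
    intro j hj
    rcases Nat.lt_succ_iff_lt_or_eq.1 hj with hj | rfl
    · exact ih (fun j hj => hx j (hj.trans n.lt_succ_self))
        (fun j hj => hy j (hj.trans n.lt_succ_self)) hdiv j hj
    · exact hmod

theorem le_dist_digitSum {x y : ℕ → ℕ} {n : ℕ} (hx : ∀ j < n, x j < 2 ^ (2 * j + 1))
    (hy : ∀ j < n, y j < 2 ^ (2 * j + 1)) {j : ℕ} (hj : j < n) (hne : x j ≠ y j) :
    1 / 2 ^ (n ^ 2) ≤ dist (digitSum n x) (digitSum n y) := by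
  have h : digitNum x n ≠ digitNum y n := fun h => hne (digitNum_inj hx hy h j hj)
  have h1 : (1 : ℝ) ≤ |(digitNum x n : ℝ) - digitNum y n| := by
    have : (1 : ℤ) ≤ |(digitNum x n : ℤ) - digitNum y n| :=
      Int.one_le_abs (sub_ne_zero.2 (by exact_mod_cast h))
    exact_mod_cast this
  rw [digitSum_eq, digitSum_eq, Real.dist_eq, ← sub_div, abs_div,
    abs_of_pos (by positivity : (0 : ℝ) < 2 ^ (n ^ 2))]
  gcongr

theorem digit_term_le {k j : ℕ} (h : k < 2 ^ (2 * j + 1)) :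
    (k : ℝ) / 2 ^ ((j + 1) ^ 2) ≤ 1 / 2 ^ (j ^ 2) - 1 / 2 ^ ((j + 1) ^ 2) := by
  have h1 : (k : ℝ) + 1 ≤ 2 ^ (2 * j + 1) := by exact_mod_cast h
  rw [two_pow_succ_sq, div_sub_div _ _ (by positivity) (by positivity),
    div_le_div_iff₀ (by positivity) (by positivity)]
  have : (0 : ℝ) < 2 ^ (j ^ 2) := by positivity
  have h2 : (0 : ℝ) < 2 ^ (2 * j + 1) := by positivity
  nlinarith [mul_le_mul_of_nonneg_left h1 (by positivity :
    (0 : ℝ) ≤ 2 ^ (j ^ 2) * (2 ^ (j ^ 2) * 2 ^ (2 * j + 1)))]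

theorem digitSum_mono {x : ℕ → ℕ} {n N : ℕ} (h : n ≤ N) : digitSum n x ≤ digitSum N x :=
  Finset.sum_le_sum_of_subset_of_nonneg (Finset.range_mono h) fun _ _ _ => by positivity

theorem digitSum_le_add {x : ℕ → ℕ} (hx : ∀ j, x j < 2 ^ (2 * j + 1)) {n N : ℕ} (h : n ≤ N) :
    digitSum N x ≤ digitSum n x + (1 / 2 ^ (n ^ 2) - 1 / 2 ^ (N ^ 2)) := by
  induction N, h using Nat.le_induction with
  | base => simp
  | succ N _ ih =>
    have : digitSum (N + 1) x = digitSum N x + (x N : ℝ) / 2 ^ ((N + 1) ^ 2) :=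
      Finset.sum_range_succ _ _
    have := digit_term_le (hx N)
    linarith

theorem digitSum_le {x : ℕ → ℕ} (hx : ∀ j, x j < 2 ^ (2 * j + 1)) (n N : ℕ) :
    digitSum N x ≤ digitSum n x + 1 / 2 ^ (n ^ 2) := by
  have hpos : ∀ k : ℕ, (0 : ℝ) < 1 / 2 ^ (k ^ 2) := fun k => by positivity
  rcases le_total n N with h | h
  · linarith [digitSum_le_add hx h, hpos N]
  · linarith [digitSum_mono (x := x) h, hpos n]

theorem summable_digit {x : ℕ → ℕ} (hx : ∀ j, x j < 2 ^ (2 * j + 1)) :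
    Summable fun j => (x j : ℝ) / 2 ^ ((j + 1) ^ 2) :=
  summable_of_sum_range_le (fun _ => by positivity) fun N => digitSum_le hx 0 N

theorem digitSum_le_digitVal {x : ℕ → ℕ} (hx : ∀ j, x j < 2 ^ (2 * j + 1)) (n : ℕ) :
    digitSum n x ≤ digitVal x :=
  (summable_digit hx).sum_le_tsum _ fun _ _ => by positivity

theorem digitVal_le {x : ℕ → ℕ} (hx : ∀ j, x j < 2 ^ (2 * j + 1)) (n : ℕ) :
    digitVal x ≤ digitSum n x + 1 / 2 ^ (n ^ 2) :=
  Real.tsum_le_of_sum_range_le (fun _ => by positivity) fun N => digitSum_le hx n N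

theorem dist_digitVal_digitSum_le {x : ℕ → ℕ} (hx : ∀ j, x j < 2 ^ (2 * j + 1)) (n : ℕ) :
    dist (digitVal x) (digitSum n x) ≤ 1 / 2 ^ (n ^ 2) := by
  rw [Real.dist_eq, abs_le]
  have : (0 : ℝ) < 1 / 2 ^ (n ^ 2) := by positivity
  constructor <;> linarith [digitSum_le_digitVal hx n, digitVal_le hx n]

theorem digitVal_eq_digitSum {x : ℕ → ℕ} {n : ℕ} (hx : ∀ j, n ≤ j → x j = 0) :
    digitVal x = digitSum n x :=
  tsum_eq_sum fun j hj => by simp [hx j (by simpa using hj)]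

section DigitSet

variable {L : ℕ → ℕ}

theorem digit_lt (hL : ∀ j, L j < 2 ^ (2 * j + 1)) {x : ℕ → ℕ} (hx : ∀ j, x j ≤ L j) (j : ℕ) :
    x j < 2 ^ (2 * j + 1) :=
  (hx j).trans_lt (hL j)

theorem zero_mem_digitSet : (0 : ℝ) ∈ digitSet L :=
  ⟨fun _ => 0, fun _ => Nat.zero_le _, by simp [digitVal]⟩

theorem digitSet_subset_Icc (hL : ∀ j, L j < 2 ^ (2 * j + 1)) : digitSet L ⊆ Icc 0 1 := by
  rintro _ ⟨x, hx, rfl⟩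
  refine ⟨tsum_nonneg fun _ => by positivity, ?_⟩
  simpa [digitSum] using digitVal_le (digit_lt hL hx) 0

theorem continuous_digitVal_coe (hL : ∀ j, L j < 2 ^ (2 * j + 1)) :
    Continuous fun z : ∀ j, Fin (L j + 1) => digitVal fun j => z j := by
  refine continuous_tsum (u := fun j => ((2 ^ (2 * j + 1) - 1 : ℕ) : ℝ) / 2 ^ ((j + 1) ^ 2))
    (fun j => ?_) (summable_digit fun j => ?_) fun j z => ?_
  · exact (continuous_of_discreteTopology (f := fun k : Fin (L j + 1) =>
      ((k : ℕ) : ℝ) / 2 ^ ((j + 1) ^ 2))).comp (continuous_apply j)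
  · exact Nat.sub_lt (by positivity) one_pos
  · rw [Real.norm_of_nonneg (by positivity)]
    gcongr
    exact Nat.le_sub_one_of_lt (lt_of_lt_of_le (z j).2 (hL j))

theorem digitSet_eq_range :
    digitSet L = range fun z : ∀ j, Fin (L j + 1) => digitVal fun j => z j := by
  ext r
  constructor
  · rintro ⟨x, hx, rfl⟩
    exact ⟨fun j => ⟨x j, Nat.lt_succ_of_le (hx j)⟩, rfl⟩
  · rintro ⟨z, rfl⟩
    exact ⟨_, fun j => Nat.le_of_lt_succ (z j).2, rfl⟩

theorem isCompact_digitSet (hL : ∀ j, L j < 2 ^ (2 * j + 1)) : IsCompact (digitSet L) := by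
  rw [digitSet_eq_range]
  exact isCompact_range (continuous_digitVal_coe hL)

/-- The digit sequence which is given by `t` at the places in `F` and by `x` elsewhere. -/
def spliceDigits (L x : ℕ → ℕ) {F : Finset ℕ} (t : ∀ j : F, Fin (L j + 1)) (j : ℕ) : ℕ :=
  if h : j ∈ F then t ⟨j, h⟩ else x j

theorem spliceDigits_le {x : ℕ → ℕ} (hx : ∀ j, x j ≤ L j) {F : Finset ℕ}
    (t : ∀ j : F, Fin (L j + 1)) (j : ℕ) : spliceDigits L x t j ≤ L j := by
  unfold spliceDigits
  split_ifs with h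
  · exact Nat.le_of_lt_succ (t ⟨j, h⟩).2
  · exact hx j

theorem card_digits (F : Finset ℕ) :
    Fintype.card (∀ j : F, Fin (L j + 1)) = ∏ j ∈ F, (L j + 1) := by
  rw [Fintype.card_pi]
  simp only [Fintype.card_fin]
  exact Finset.prod_coe_sort F fun j => L j + 1

theorem exists_digitSum_spliceDigits {x : ℕ → ℕ} (hx : ∀ j, x j ≤ L j) (n : ℕ) :
    ∃ t : ∀ j : Finset.range n, Fin (L j + 1),
      digitSum n (spliceDigits L 0 t) = digitSum n x := by
  refine ⟨fun j => ⟨x j, Nat.lt_succ_of_le (hx j)⟩, Finset.sum_congr rfl fun j hj => ?_⟩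
  simp [spliceDigits, Finset.mem_range.1 hj]

theorem digitCount_le (hL : ∀ j, L j < 2 ^ (2 * j + 1)) (n : ℕ) : digitCount L n ≤ 2 ^ (n ^ 2) := by
  induction n with
  | zero => simp [digitCount]
  | succ n ih =>
    rw [digitCount, Finset.prod_range_succ]
    calc _ ≤ 2 ^ (n ^ 2) * 2 ^ (2 * n + 1) := Nat.mul_le_mul ih (hL n)
      _ = 2 ^ ((n + 1) ^ 2) := by rw [← pow_add]; congr 1; ring

variable {ι : Type*} [Fintype ι] {γ : ℝ}

theorem isBounded_pi_digitSet (hL : ∀ j, L j < 2 ^ (2 * j + 1)) :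
    Bornology.IsBounded (univ.pi fun _ : ι => digitSet L) :=
  (isCompact_univ_pi fun _ => isCompact_digitSet hL).isBounded

theorem upperBoxDim_pi_digitSet_le (hL : ∀ j, L j < 2 ^ (2 * j + 1)) (hγ : 0 ≤ γ)
    (hcount : ∀ n : ℕ, (digitCount L n : ℝ) ≤ 2 ^ (γ * (n : ℝ) ^ 2)) :
    upperBoxDim (univ.pi fun _ : ι => digitSet L) ≤ ((Fintype.card ι * γ : ℝ) : EReal) := by
  classical
  refine upperBoxDim_le_of_square_scales (C := 2) (by positivity) two_pos fun ε hε => ?_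
  refine Eventually.of_forall fun n => ⟨digitCount L n ^ Fintype.card ι, ?_, ?_⟩
  · have h := coveredBy_of_net (I := ι → ∀ j : Finset.range n, Fin (L j + 1)) (r := 1 / 2 ^ (n ^ 2))
      (X := univ.pi fun _ : ι => digitSet L)
      (fun t i => digitSum n (spliceDigits L 0 (t i))) ?_
    · rw [Fintype.card_fun, card_digits] at h
      rwa [mul_one_div] at h
    · intro a ha
      choose x hx hxa using fun i => ha i (mem_univ i)
      choose t ht using fun i => exists_digitSum_spliceDigits (hx i) n
      refine ⟨t, (dist_pi_le_iff (by positivity)).2 fun i => ?_⟩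
      rw [ht, ← hxa]
      exact dist_digitVal_digitSum_le (digit_lt hL (hx i)) n
  · push_cast
    calc (digitCount L n : ℝ) ^ Fintype.card ι
        ≤ (2 ^ (γ * (n : ℝ) ^ 2)) ^ Fintype.card ι := by
          gcongr
          exact hcount n
      _ = 2 ^ ((Fintype.card ι * γ) * (n : ℝ) ^ 2) := by
          rw [← Real.rpow_natCast, ← Real.rpow_mul two_pos.le]
          congr 1
          ring
      _ ≤ _ := by
          refine Real.rpow_le_rpow_of_exponent_le one_le_two ?_
          gcongr
          linarith

/-- Lower bound for the packing dimension of a power of a digit set. By Baire's theorem, one member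
of any countable closed cover contains all points whose first `n₀` digits are prescribed; truncating
the expansions of these points at a place `N` with many digit strings gives many points at mutual
distance at least `2 ^ (-N ^ 2)`. -/
theorem le_packingDim_pi_digitSet (hL : ∀ j, L j < 2 ^ (2 * j + 1))
    (hcount : ∃ᶠ N : ℕ in atTop, (2 : ℝ) ^ (γ * (N : ℝ) ^ 2 - 2 * N) ≤ digitCount L N) :
    ((Fintype.card ι * γ : ℝ) : EReal) ≤ packingDim (univ.pi fun _ : ι => digitSet L) := by
  classical
  refine le_iInf₂ fun Y hY => ?_
  by_contra! hlt
  obtain ⟨c, hc, hcγ⟩ := EReal.lt_iff_exists_real_btwn.1 hlt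
  have hcγ : c < Fintype.card ι * γ := by exact_mod_cast hcγ
  set f : (ι → ∀ j, Fin (L j + 1)) → ι → ℝ := fun z i => digitVal fun j => z i j with hf
  have hfc : Continuous f :=
    continuous_pi fun i => (continuous_digitVal_coe hL).comp (continuous_apply i)
  obtain ⟨k, z₀, hz₀⟩ := nonempty_interior_of_iUnion_of_closed
    (f := fun k => f ⁻¹' closure (Y k)) (fun k => isClosed_closure.preimage hfc) (by
      refine eq_univ_of_forall fun z => ?_
      have hz : f z ∈ univ.pi fun _ : ι => digitSet L := fun i _ => by
        rw [digitSet_eq_range]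
        exact ⟨z i, rfl⟩
      obtain ⟨k, hk⟩ := mem_iUnion.1 (hY.2 hz)
      exact mem_iUnion.2 ⟨k, subset_closure hk⟩)
  obtain ⟨n₀, hn₀⟩ : ∃ n₀, ∀ z : ι → ∀ j, Fin (L j + 1),
      (∀ i, ∀ j < n₀, z i j = z₀ i j) → f z ∈ closure (Y k) := by
    by_contra! hcon
    choose z hz hzY using hcon
    have hlim : Tendsto z atTop (𝓝 z₀) := by
      refine tendsto_pi_nhds.2 fun i => tendsto_pi_nhds.2 fun j => ?_
      refine tendsto_const_nhds.congr' ?_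
      filter_upwards [eventually_gt_atTop j] with n hn
      exact (hz n i j hn).symm
    obtain ⟨n, hn⟩ := (hlim.eventually (mem_interior_iff_mem_nhds.1 hz₀)).exists
    exact hzY n hn
  -- Scales strictly below the separation `2 ^ (-N ^ 2)` of the truncated expansions.
  have hscale : Tendsto (fun N : ℕ => (1 : ℝ) / 2 ^ (N ^ 2 + 1)) atTop (𝓝[>] 0) := by
    refine tendsto_nhdsWithin_iff.2 ⟨?_, Eventually.of_forall fun N => ?_⟩
    · have h1 : Tendsto (fun N : ℕ => N ^ 2 + 1) atTop atTop :=
        tendsto_atTop_mono (fun N => by nlinarith : ∀ N : ℕ, N ≤ N ^ 2 + 1) tendsto_id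
      have h2 := (tendsto_pow_atTop_nhds_zero_of_lt_one (r := (1 / 2 : ℝ)) (by norm_num)
        (by norm_num)).comp h1
      simpa [Function.comp_def] using h2
    · exact mem_Ioi.2 (by positivity)
  have hYc : upperBoxDim (Y k) < c := (le_iSup (fun i => upperBoxDim (Y i)) k).trans_lt hc
  set q : ℝ := (Fintype.card ι : ℝ) with hq
  have hη : 0 < q * γ - c := sub_pos.2 hcγ
  obtain ⟨N, hN, ⟨m, hcov, hm⟩, hNn₀, hNbig, hN1⟩ := (hcount.and_eventually
    ((hscale.eventually (eventually_coveredBy_of_upperBoxDim_lt hYc)).and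
      ((eventually_ge_atTop n₀).and (((tendsto_natCast_atTop_atTop (R := ℝ)).eventually_gt_atTop
        ((2 * q + q * n₀ ^ 2 + |c|) / (q * γ - c))).and (eventually_ge_atTop 1))))).exists
  -- The separated family: digits of `z₀` before `n₀`, arbitrary digits from `n₀` to `N`, then zeros.
  set base : ι → ℕ → ℕ := fun i j => if j < n₀ then z₀ i j else 0 with hbase
  have hbase_le : ∀ i j, base i j ≤ L j := by
    intro i j
    simp only [hbase]
    split_ifs
    · exact Nat.le_of_lt_succ (z₀ i j).2
    · exact Nat.zero_le _
  set dig : (ι → ∀ j : Finset.Ico n₀ N, Fin (L j + 1)) → ι → ℕ → ℕ :=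
    fun t i => spliceDigits L (base i) (t i) with hdig
  have hdig_le : ∀ t i j, dig t i j ≤ L j := fun t i j => spliceDigits_le (hbase_le i) (t i) j
  have hdig_zero : ∀ t i j, N ≤ j → dig t i j = 0 := by
    intro t i j hj
    have h1 : ¬ j < N := not_lt.2 hj
    have h2 : ¬ j < n₀ := not_lt.2 (hNn₀.trans hj)
    simp [hdig, spliceDigits, hbase, h1, h2]
  have hcard := hcov.card_le_of_separated (by positivity) (fun t i => digitVal (dig t i))
    (fun t => by
      refine hn₀ (fun i j => ⟨dig t i j, Nat.lt_succ_of_le (hdig_le t i j)⟩) fun i j hj => ?_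
      have h1 : ¬ n₀ ≤ j := not_le.2 hj
      simp [hdig, spliceDigits, hbase, hj, h1])
    (fun t t' htt' => by
      obtain ⟨i, hi⟩ := Function.ne_iff.1 htt'
      obtain ⟨⟨j, hj⟩, hij⟩ := Function.ne_iff.1 hi
      refine lt_of_lt_of_le ?_ (dist_le_pi_dist _ _ i)
      rw [digitVal_eq_digitSum (hdig_zero t i), digitVal_eq_digitSum (hdig_zero t' i)]
      refine lt_of_lt_of_le ?_ (le_dist_digitSum (j := j)
        (fun j _ => digit_lt hL (hdig_le t i) j) (fun j _ => digit_lt hL (hdig_le t' i) j)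
        (Finset.mem_Ico.1 hj).2 ?_)
      · exact one_div_lt_one_div_of_lt (by positivity)
          (pow_lt_pow_right₀ one_lt_two (Nat.lt_succ_self _))
      · simp only [hdig, spliceDigits, hj, dif_pos]
        exact fun h => hij (Fin.ext h))
  rw [Fintype.card_fun, card_digits] at hcard
  have hprod : (2 : ℝ) ^ (γ * (N : ℝ) ^ 2 - 2 * N - n₀ ^ 2)
      ≤ ((∏ j ∈ Finset.Ico n₀ N, (L j + 1) : ℕ) : ℝ) := by
    have h1 : digitCount L n₀ * ∏ j ∈ Finset.Ico n₀ N, (L j + 1) = digitCount L N :=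
      Finset.prod_range_mul_prod_Ico _ hNn₀
    have h2 : (digitCount L n₀ : ℝ) ≤ 2 ^ (n₀ ^ 2) := by exact_mod_cast digitCount_le hL n₀
    rw [Real.rpow_sub two_pos, div_le_iff₀ (by positivity)]
    calc _ ≤ (digitCount L N : ℝ) := hN
      _ = digitCount L n₀ * ((∏ j ∈ Finset.Ico n₀ N, (L j + 1) : ℕ) : ℝ) := by
        rw [← h1]; push_cast; rfl
      _ ≤ 2 ^ (n₀ ^ 2) * ((∏ j ∈ Finset.Ico n₀ N, (L j + 1) : ℕ) : ℝ) := by gcongr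
      _ = _ := by rw [mul_comm, ← Nat.cast_pow, Real.rpow_natCast]
  have hfinal : (2 : ℝ) ^ ((γ * (N : ℝ) ^ 2 - 2 * N - n₀ ^ 2) * q) ≤ 2 ^ (((N : ℝ) ^ 2 + 1) * c) := by
    calc (2 : ℝ) ^ ((γ * (N : ℝ) ^ 2 - 2 * N - n₀ ^ 2) * q)
        = (2 ^ (γ * (N : ℝ) ^ 2 - 2 * N - n₀ ^ 2)) ^ Fintype.card ι := by
          rw [Real.rpow_mul two_pos.le, hq, Real.rpow_natCast]
      _ ≤ ((∏ j ∈ Finset.Ico n₀ N, (L j + 1) : ℕ) : ℝ) ^ Fintype.card ι := by gcongr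
      _ ≤ m := by exact_mod_cast hcard
      _ ≤ _ := hm
      _ = _ := by
        rw [one_div, Real.inv_rpow (by positivity), ← Real.rpow_neg (by positivity), neg_neg,
          ← Real.rpow_natCast, ← Real.rpow_mul two_pos.le]
        push_cast
        rfl
  have hle := (Real.rpow_le_rpow_left_iff one_lt_two).1 hfinal
  rw [div_lt_iff₀ hη] at hNbig
  have hN1' : (1 : ℝ) ≤ N := by exact_mod_cast hN1
  have hq0 : 0 ≤ q := Nat.cast_nonneg _
  have h1 := mul_lt_mul_of_pos_right hNbig (by linarith : (0 : ℝ) < N)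
  have h2 : q * n₀ ^ 2 ≤ q * n₀ ^ 2 * N := le_mul_of_one_le_right (by positivity) hN1'
  have h3 : |c| ≤ |c| * N := le_mul_of_one_le_right (abs_nonneg _) hN1'
  have h4 := le_abs_self c
  nlinarith

end DigitSet

/-! ### Digit bounds active on sparse ranges of scales -/

/-- The places are divided into phases; for `h ≥ 1` the `h`-th phase consists of the places `j` with
`2 ^ 4 ^ h ≤ j < (2 ^ 4 ^ h) ^ 4`, and the phase `0` of those below `2 ^ 4`. -/
def phase (j : ℕ) : ℕ := Nat.log 4 (Nat.log 2 j)

/-- Digit bounds of density `γ`: in the phases congruent to `r` modulo `4` the `j`-th digit,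
which stands for `2 * j + 1` binary places, may take about `2 ^ (γ * (2 * j + 1))` values, and in
the other phases it is `0`. -/
noncomputable def phaseBound (r : ℕ) (γ : ℝ) (j : ℕ) : ℕ :=
  if phase j % 4 = r then ⌊(2 : ℝ) ^ (γ * (2 * j + 1))⌋₊ - 1 else 0

theorem phase_mono {i j : ℕ} (h : i ≤ j) : phase i ≤ phase j :=
  Nat.log_mono_right (Nat.log_mono_right h)

theorem phase_two_pow (h : ℕ) : phase (2 ^ 4 ^ h) = h := by
  rw [phase, Nat.log_pow (by norm_num), Nat.log_pow (by norm_num)]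

theorem two_pow_four_pow_succ (h : ℕ) : 2 ^ 4 ^ (h + 1) = (2 ^ 4 ^ h) ^ 4 := by
  rw [← pow_mul, pow_succ]

theorem phase_lt {h j : ℕ} (hj : j < 2 ^ 4 ^ (h + 1)) : phase j < h + 1 := by
  rcases Nat.eq_zero_or_pos j with rfl | hpos
  · simp [phase]
  have h1 : Nat.log 2 j < 4 ^ (h + 1) := (Nat.log_lt_iff_lt_pow (by norm_num) hpos.ne').2 hj
  rw [phase]
  rcases Nat.eq_zero_or_pos (Nat.log 2 j) with h0 | h0
  · simp [h0]
  · exact (Nat.log_lt_iff_lt_pow (by norm_num) h0.ne').2 h1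

/-- Just before any place `n`, either the phases `≡ 0` or the phases `≡ 2` have not been visited
since a place `q` which is negligible compared to `n`. -/
theorem exists_idle_range (n : ℕ) : ∃ q : ℕ, q ^ 4 ≤ n ∧
    ((∀ j, q ≤ j → j < n → phase j % 4 ≠ 0) ∨ ∀ j, q ≤ j → j < n → phase j % 4 ≠ 2) := by
  rcases h : phase n with _ | h'
  · refine ⟨0, by simp, Or.inr fun j _ hj => ?_⟩
    have := phase_mono hj.le
    omega
  · refine ⟨2 ^ 4 ^ h', ?_, ?_⟩
    · rw [← two_pow_four_pow_succ]
      by_contra! hlt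
      have := phase_lt hlt
      omega
    · have key : ∀ j, 2 ^ 4 ^ h' ≤ j → j < n → phase j = h' ∨ phase j = h' + 1 := by
        intro j h1 h2
        have h3 := phase_mono h1
        have h4 := phase_mono h2.le
        rw [phase_two_pow] at h3
        omega
      rcases (by omega : (h' % 4 = 1 ∨ h' % 4 = 2) ∨ (h' % 4 = 3 ∨ h' % 4 = 0)) with hm | hm
      · refine Or.inl fun j h1 h2 => ?_
        have := key j h1 h2
        omega
      · refine Or.inr fun j h1 h2 => ?_
        have := key j h1 h2
        omega

section PhaseBound

variable {r : ℕ} {γ : ℝ}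

theorem phaseBound_succ_le (hγ : 0 ≤ γ) (j : ℕ) :
    ((phaseBound r γ j + 1 : ℕ) : ℝ) ≤ 2 ^ (γ * (2 * j + 1)) := by
  have h1 : (1 : ℝ) ≤ 2 ^ (γ * (2 * j + 1)) := Real.one_le_rpow one_le_two (by positivity)
  unfold phaseBound
  split_ifs
  · rw [Nat.sub_add_cancel ((Nat.one_le_floor_iff _).2 h1)]
    exact Nat.floor_le (by positivity)
  · simpa using h1

theorem phaseBound_lt (hγ : 0 ≤ γ) (hγ1 : γ ≤ 1) (j : ℕ) : phaseBound r γ j < 2 ^ (2 * j + 1) := by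
  have h : (2 : ℝ) ^ (γ * (2 * j + 1)) ≤ 2 ^ ((2 * j + 1 : ℕ) : ℝ) := by
    refine Real.rpow_le_rpow_of_exponent_le one_le_two ?_
    push_cast
    exact mul_le_of_le_one_left (by positivity) hγ1
  rw [Real.rpow_natCast] at h
  exact Nat.lt_of_succ_le (by exact_mod_cast (phaseBound_succ_le hγ j).trans h)

theorem digitCount_phaseBound_le (hγ : 0 ≤ γ) (n : ℕ) :
    (digitCount (phaseBound r γ) n : ℝ) ≤ 2 ^ (γ * (n : ℝ) ^ 2) := by
  induction n with
  | zero => simp [digitCount]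
  | succ n ih =>
    rw [digitCount, Finset.prod_range_succ, Nat.cast_mul]
    calc _ ≤ (2 : ℝ) ^ (γ * (n : ℝ) ^ 2) * 2 ^ (γ * (2 * n + 1)) :=
          mul_le_mul ih (phaseBound_succ_le hγ n) (by positivity) (by positivity)
      _ = _ := by
        rw [← Real.rpow_add two_pos]
        push_cast
        congr 1
        ring

theorem le_phaseBound_succ {j : ℕ} (hj : phase j % 4 = r) :
    (2 : ℝ) ^ (γ * (2 * j + 1) - 1) ≤ ((phaseBound r γ j + 1 : ℕ) : ℝ) := by
  have h1 := Nat.lt_floor_add_one ((2 : ℝ) ^ (γ * (2 * j + 1)))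
  have h2 : ⌊(2 : ℝ) ^ (γ * (2 * j + 1))⌋₊ ≤ phaseBound r γ j + 1 := by
    rw [phaseBound, if_pos hj]
    omega
  have h3 : (⌊(2 : ℝ) ^ (γ * (2 * j + 1))⌋₊ : ℝ) ≤ ((phaseBound r γ j + 1 : ℕ) : ℝ) := by
    exact_mod_cast h2
  have h4 : (1 : ℝ) ≤ ((phaseBound r γ j + 1 : ℕ) : ℝ) := by exact_mod_cast Nat.le_add_left _ _
  rw [Real.rpow_sub_one two_ne_zero, div_le_iff₀ two_pos]
  linarith

theorem le_digitCount_phaseBound {K N : ℕ} (hKN : K ≤ N)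
    (h : ∀ j, K ≤ j → j < N → phase j % 4 = r) :
    (2 : ℝ) ^ (γ * ((N : ℝ) ^ 2 - K ^ 2) - (N - K)) ≤ digitCount (phaseBound r γ) N := by
  induction N, hKN using Nat.le_induction with
  | base =>
    have : 1 ≤ digitCount (phaseBound r γ) K := Finset.one_le_prod' fun _ _ => Nat.le_add_left _ _
    simpa using this
  | succ N hN ih =>
    rw [digitCount, Finset.prod_range_succ, Nat.cast_mul]
    calc _ = (2 : ℝ) ^ (γ * ((N : ℝ) ^ 2 - K ^ 2) - (N - K)) * 2 ^ (γ * (2 * N + 1) - 1) := by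
          rw [← Real.rpow_add two_pos]
          push_cast
          congr 1
          ring
      _ ≤ _ := mul_le_mul (ih fun j h1 h2 => h j h1 (h2.trans N.lt_succ_self))
          (le_phaseBound_succ (h N hN N.lt_succ_self)) (by positivity) (by positivity)

theorem frequently_le_digitCount_phaseBound (hr : r < 4) (hγ1 : γ ≤ 1) :
    ∃ᶠ N : ℕ in atTop,
      (2 : ℝ) ^ (γ * (N : ℝ) ^ 2 - 2 * N) ≤ digitCount (phaseBound r γ) N := by
  refine frequently_atTop.2 fun a => ?_
  -- `N = K ^ 4` is the end of an active phase starting at `K`. The earlier places are negligible,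
  -- as `K ^ 2 ≤ N`, and rounding the number of digits down costs at most one factor `2` per place.
  set h := 4 * a + r with hh
  set K := 2 ^ 4 ^ h with hK
  have hah : a ≤ K := by
    have h1 := Nat.lt_pow_self (n := h) (by norm_num : 1 < 4)
    have h2 := Nat.lt_pow_self (n := 4 ^ h) (by norm_num : 1 < 2)
    omega
  have hK1 : 1 ≤ K := Nat.one_le_two_pow
  have hKN : K ≤ K ^ 4 := Nat.le_self_pow (by norm_num) K
  refine ⟨K ^ 4, hah.trans hKN, le_trans ?_ (le_digitCount_phaseBound hKN fun j h1 h2 => ?_)⟩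
  · refine Real.rpow_le_rpow_of_exponent_le one_le_two ?_
    have h1 : (K : ℝ) ^ 2 ≤ ((K ^ 4 : ℕ) : ℝ) := by
      exact_mod_cast Nat.pow_le_pow_right hK1 (by norm_num)
    have h2 : γ * (K : ℝ) ^ 2 ≤ K ^ 2 := mul_le_of_le_one_left (by positivity) hγ1
    have h3 : (0 : ℝ) ≤ K := Nat.cast_nonneg _
    linarith
  · have h3 := phase_mono h1
    rw [hK, phase_two_pow] at h3
    rw [hK, ← two_pow_four_pow_succ] at h2
    have h4 := phase_lt h2
    omega

theorem packingDim_pi_digitSet_phaseBound {ι : Type*} [Fintype ι] (hr : r < 4) (hγ : 0 ≤ γ)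
    (hγ1 : γ ≤ 1) :
    packingDim (univ.pi fun _ : ι => digitSet (phaseBound r γ))
      = ((Fintype.card ι * γ : ℝ) : EReal) :=
  le_antisymm
    ((packingDim_le_upperBoxDim (isBounded_pi_digitSet (phaseBound_lt hγ hγ1))).trans
      (upperBoxDim_pi_digitSet_le (phaseBound_lt hγ hγ1) hγ (digitCount_phaseBound_le hγ)))
    (le_packingDim_pi_digitSet (phaseBound_lt hγ hγ1)
      (frequently_le_digitCount_phaseBound hr hγ1))

end PhaseBound

/-! ### Projections onto lines through the origin -/

section Projections

variable {E : Type*} [NormedAddCommGroup E] [InnerProductSpace ℝ E]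

theorem norm_normalize_sub_le {v w : E} (hv : 1 ≤ ‖v‖) (hw : 1 ≤ ‖w‖) :
    ‖(‖v‖⁻¹ • v) - ‖w‖⁻¹ • w‖ ≤ 2 * ‖v - w‖ := by
  have hv0 : 0 < ‖v‖ := by linarith
  have hw0 : 0 < ‖w‖ := by linarith
  have e : (‖v‖⁻¹ • v) - ‖w‖⁻¹ • w = ‖v‖⁻¹ • (v - w) + (‖v‖⁻¹ * (‖w‖ - ‖v‖) * ‖w‖⁻¹) • w := by
    have : ‖v‖⁻¹ * (‖w‖ - ‖v‖) * ‖w‖⁻¹ = ‖v‖⁻¹ - ‖w‖⁻¹ := by field_simp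
    rw [this, smul_sub, sub_smul]
    abel
  have hinv : ‖v‖⁻¹ ≤ 1 := inv_le_one_of_one_le₀ hv
  rw [e]
  refine (norm_add_le _ _).trans ?_
  rw [norm_smul, norm_smul, norm_mul, norm_mul, norm_inv, norm_inv, norm_norm, norm_norm,
    mul_assoc _ _ ‖w‖, inv_mul_cancel₀ hw0.ne', mul_one]
  have h1 : ‖‖w‖ - ‖v‖‖ ≤ ‖v - w‖ := by
    rw [norm_sub_rev v w]
    exact abs_norm_sub_norm_le w v
  have h2 : ‖v‖⁻¹ * ‖v - w‖ ≤ 1 * ‖v - w‖ := by gcongr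
  have h3 : ‖v‖⁻¹ * ‖‖w‖ - ‖v‖‖ ≤ 1 * ‖v - w‖ := by gcongr
  linarith

theorem starProjection_span_eq {v : E} (w : E) :
    (Submodule.span ℝ {v}).starProjection w = inner ℝ (‖v‖⁻¹ • v) w • (‖v‖⁻¹ • v) := by
  rw [Submodule.starProjection_singleton, smul_smul, inner_smul_left]
  congr 1
  simp
  ring

theorem norm_starProjection_span_sub_le {v w : E} (hv : 1 ≤ ‖v‖) (hw : 1 ≤ ‖w‖) :
    ‖(Submodule.span ℝ {v}).starProjection - (Submodule.span ℝ {w}).starProjection‖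
      ≤ 4 * ‖v - w‖ := by
  refine ContinuousLinearMap.opNorm_le_bound _ (by positivity) fun x => ?_
  have hunit : ∀ u : E, 1 ≤ ‖u‖ → ‖‖u‖⁻¹ • u‖ = 1 := fun u hu => by
    rw [norm_smul, norm_inv, norm_norm, inv_mul_cancel₀ (by linarith)]
  have h := norm_normalize_sub_le hv hw
  have hv1 := hunit v hv
  have hw1 := hunit w hw
  rw [sub_apply, starProjection_span_eq, starProjection_span_eq]
  generalize ‖v‖⁻¹ • v = e at *
  generalize ‖w‖⁻¹ • w = g at *
  have e1 : inner ℝ e x • e - inner ℝ g x • g = inner ℝ (e - g) x • e + inner ℝ g x • (e - g) := by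
    rw [inner_sub_left, sub_smul, smul_sub]
    abel
  rw [e1]
  refine (norm_add_le _ _).trans ?_
  rw [norm_smul, norm_smul, hv1]
  have h1 := norm_inner_le_norm (𝕜 := ℝ) (e - g) x
  have h2 := norm_inner_le_norm (𝕜 := ℝ) g x
  rw [hw1] at h2
  nlinarith [norm_nonneg x, norm_nonneg (e - g), mul_le_mul_of_nonneg_right h (norm_nonneg x),
    mul_le_mul_of_nonneg_right h2 (norm_nonneg (e - g))]

end Projections

/-! ### Lines through two parallel hyperplanes -/

section Lines

variable {m : ℕ}

/-- The point of `ℝ ^ (m + 1)` with first coordinate `y` and remaining coordinates `a`. -/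
noncomputable def pt (a : Fin m → ℝ) (y : ℝ) : EuclideanSpace ℝ (Fin (m + 1)) :=
  WithLp.toLp 2 (Fin.cons y a)

@[simp] theorem pt_zero_apply (a : Fin m → ℝ) (y : ℝ) : pt a y 0 = y := rfl

@[simp] theorem pt_succ_apply (a : Fin m → ℝ) (y : ℝ) (i : Fin m) : pt a y i.succ = a i := rfl

theorem pt_sub (a a' : Fin m → ℝ) (y y' : ℝ) : pt a y - pt a' y' = pt (a - a') (y - y') := by
  ext i
  refine Fin.cases ?_ (fun i => ?_) i <;> simp

theorem pt_add_smul (a v : Fin m → ℝ) (y z c : ℝ) :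
    pt a y + c • pt v z = pt (a + c • v) (y + c * z) := by
  ext i
  refine Fin.cases ?_ (fun i => ?_) i <;> simp

theorem norm_pt_le {a : Fin m → ℝ} {y M : ℝ} (ha : ∀ i, |a i| ≤ M) (hy : |y| ≤ M) :
    ‖pt a y‖ ≤ (m + 1) * M := by
  have hM : 0 ≤ M := (abs_nonneg y).trans hy
  rw [EuclideanSpace.norm_eq, Real.sqrt_le_left (by positivity)]
  have hle : ∀ i, ‖pt a y i‖ ^ 2 ≤ M ^ 2 := by
    intro i
    refine pow_le_pow_left₀ (norm_nonneg _) ?_ 2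
    refine Fin.cases ?_ (fun i => ?_) i
    · simpa using hy
    · simpa using ha i
  refine (Finset.sum_le_card_nsmul _ _ _ fun i _ => hle i).trans ?_
  simp only [Finset.card_univ, Fintype.card_fin, nsmul_eq_mul, Nat.cast_add, Nat.cast_one]
  have hm : (0 : ℝ) ≤ m := Nat.cast_nonneg m
  nlinarith [mul_nonneg hm (sq_nonneg M), mul_nonneg (mul_nonneg hm hm) (sq_nonneg M)]

theorem abs_le_norm_pt (a : Fin m → ℝ) (y : ℝ) (i : Fin m) : |a i| ≤ ‖pt a y‖ := by
  simpa using PiLp.norm_apply_le (pt a y) i.succ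

theorem abs_le_norm_pt' (a : Fin m → ℝ) (y : ℝ) : |y| ≤ ‖pt a y‖ := by
  simpa using PiLp.norm_apply_le (pt a y) 0

theorem dist_pt_le {a a' : Fin m → ℝ} {y y' M : ℝ} (ha : ∀ i, |a i - a' i| ≤ M)
    (hy : |y - y'| ≤ M) : dist (pt a y) (pt a' y') ≤ (m + 1) * M := by
  rw [dist_eq_norm, pt_sub]
  exact norm_pt_le ha hy

theorem pt_one_ne_zero (a : Fin m → ℝ) : pt a 1 ≠ 0 := by
  intro h
  have := abs_le_norm_pt' a 1
  rw [h, norm_zero, abs_one] at this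
  linarith

theorem one_le_norm_pt_one (a : Fin m → ℝ) : 1 ≤ ‖pt a 1‖ := by
  simpa using abs_le_norm_pt' a 1

/-- The line through `(0, a)` and `(1, b)`. -/
noncomputable def lineThrough (a b : Fin m → ℝ) : AffineLine (m + 1) :=
  ⟨AffineSubspace.mk' (pt a 0) (Submodule.span ℝ {pt (b - a) 1}),
    ⟨pt a 0, AffineSubspace.self_mem_mk' _ _⟩, by
      rw [AffineSubspace.direction_mk']
      exact finrank_span_singleton (pt_one_ne_zero _)⟩

theorem direction_lineThrough (a b : Fin m → ℝ) :
    (lineThrough a b).direction = Submodule.span ℝ {pt (b - a) 1} :=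
  AffineSubspace.direction_mk' _ _

theorem pt_mem_points_lineThrough (a b : Fin m → ℝ) (y : ℝ) :
    pt (a + y • (b - a)) y ∈ (lineThrough a b).points := by
  have h : pt (a + y • (b - a)) y = pt a 0 + y • pt (b - a) 1 := by
    rw [pt_add_smul]
    simp
  change _ ∈ AffineSubspace.mk' _ _
  rw [AffineSubspace.mem_mk', h, vsub_eq_sub, add_sub_cancel_left]
  exact Submodule.smul_mem _ _ (Submodule.mem_span_singleton_self _)

theorem translation_lineThrough (a b : Fin m → ℝ) :
    (lineThrough a b).translation
      = pt a 0 - (lineThrough a b).direction.starProjection (pt a 0) := by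
  set V := (lineThrough a b).direction with hV
  have h1 : (lineThrough a b).translation - pt a 0 ∈ V := by
    have := (lineThrough a b).translation_mem
    change _ ∈ AffineSubspace.mk' _ _ at this
    rw [AffineSubspace.mem_mk', vsub_eq_sub] at this
    rwa [hV, direction_lineThrough]
  have h2 : V.starProjection (lineThrough a b).translation = 0 :=
    (Submodule.starProjection_apply_eq_zero_iff V).2 (lineThrough a b).translation_mem_orthogonal
  have h3 := (Submodule.starProjection_eq_self_iff).2 h1
  rw [map_sub, h2, zero_sub] at h3
  rw [eq_add_of_sub_eq h3.symm]
  abel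

theorem dist_lineThrough (a b a' b' : Fin m → ℝ) :
    dist (lineThrough a b) (lineThrough a' b')
      = ‖(Submodule.span ℝ {pt (b - a) 1}).starProjection
          - (Submodule.span ℝ {pt (b' - a') 1}).starProjection‖
        + ‖(lineThrough a b).translation - (lineThrough a' b').translation‖ := by
  simp only [← direction_lineThrough]
  rfl

/-- On the unit cube the line depends on its two marked points in a Lipschitz way. -/
theorem dist_lineThrough_le {a b a' b' : Fin m → ℝ} {δ : ℝ} (hδ : 0 ≤ δ) (ha' : ∀ i, |a' i| ≤ 1)
    (ha : ∀ i, |a i - a' i| ≤ δ) (hb : ∀ i, |b i - b' i| ≤ δ) :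
    dist (lineThrough a b) (lineThrough a' b')
      ≤ ((m + 2) * (8 * (m + 1)) + 2 * (m + 1)) * δ := by
  rw [dist_lineThrough, translation_lineThrough, translation_lineThrough]
  simp only [direction_lineThrough]
  have hP : ‖(Submodule.span ℝ {pt (b - a) 1}).starProjection
      - (Submodule.span ℝ {pt (b' - a') 1}).starProjection‖ ≤ 8 * (m + 1) * δ := by
    refine (norm_starProjection_span_sub_le (one_le_norm_pt_one _) (one_le_norm_pt_one _)).trans ?_
    have : dist (pt (b - a) 1) (pt (b' - a') 1) ≤ (m + 1) * (2 * δ) := by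
      refine dist_pt_le (fun i => ?_) (by simpa using hδ)
      have e : (b - a) i - (b' - a') i = (b i - b' i) - (a i - a' i) := by
        simp only [Pi.sub_apply]
        ring
      rw [e]
      linarith [abs_sub (b i - b' i) (a i - a' i), ha i, hb i]
    rw [dist_eq_norm] at this
    linarith
  have hp : ‖pt a 0 - pt a' 0‖ ≤ (m + 1) * δ := by
    rw [← dist_eq_norm]
    exact dist_pt_le ha (by simpa using hδ)
  have hp' : ‖pt a' 0‖ ≤ (m + 1) * 1 := norm_pt_le ha' (by simp)
  set V := Submodule.span ℝ {pt (b - a) 1}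
  set V' := Submodule.span ℝ {pt (b' - a') 1}
  have e : pt a 0 - V.starProjection (pt a 0) - (pt a' 0 - V'.starProjection (pt a' 0))
      = (pt a 0 - pt a' 0) - V.starProjection (pt a 0 - pt a' 0)
        - (V.starProjection - V'.starProjection) (pt a' 0) := by
    rw [map_sub, sub_apply]
    abel
  rw [e]
  have h1 : ‖V.starProjection (pt a 0 - pt a' 0)‖ ≤ ‖pt a 0 - pt a' 0‖ :=
    Submodule.norm_starProjection_apply_le V _
  have h2 := (V.starProjection - V'.starProjection).le_opNorm (pt a' 0)
  have h3 := norm_sub_le ((pt a 0 - pt a' 0) - V.starProjection (pt a 0 - pt a' 0))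
    ((V.starProjection - V'.starProjection) (pt a' 0))
  have h4 := norm_sub_le (pt a 0 - pt a' 0) (V.starProjection (pt a 0 - pt a' 0))
  have h5 : ‖V.starProjection - V'.starProjection‖ * ‖pt a' 0‖
      ≤ 8 * (m + 1) * δ * ((m + 1) * 1) := mul_le_mul hP hp' (norm_nonneg _) (by positivity)
  linarith

/-- Two lines with nearby orthogonal projections have nearby direction vectors, when these are
normalized to have first coordinate `1`. -/
theorem norm_pt_sub_pt_le (v w : Fin m → ℝ) :
    ‖pt v 1 - pt w 1‖ ≤ (1 + ‖pt v 1‖) * (‖(Submodule.span ℝ {pt v 1}).starProjection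
      - (Submodule.span ℝ {pt w 1}).starProjection‖ * ‖pt w 1‖) := by
  set V := Submodule.span ℝ {pt v 1}
  set W := Submodule.span ℝ {pt w 1}
  have hW : W.starProjection (pt w 1) = pt w 1 :=
    Submodule.starProjection_eq_self_iff.2 (Submodule.mem_span_singleton_self _)
  obtain ⟨l, hl⟩ := Submodule.mem_span_singleton.1 (V.starProjection_apply_mem (pt w 1))
  have h1 : ‖l • pt v 1 - pt w 1‖
      ≤ ‖V.starProjection - W.starProjection‖ * ‖pt w 1‖ := by
    have := (V.starProjection - W.starProjection).le_opNorm (pt w 1)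
    rwa [sub_apply, hW, ← hl] at this
  have h2 : |l - 1| ≤ ‖l • pt v 1 - pt w 1‖ := by
    simpa using PiLp.norm_apply_le (l • pt v 1 - pt w 1) 0
  have e : pt v 1 - pt w 1 = (l • pt v 1 - pt w 1) - (l - 1) • pt v 1 := by
    rw [sub_smul, one_smul]
    abel
  calc ‖pt v 1 - pt w 1‖ ≤ ‖l • pt v 1 - pt w 1‖ + |l - 1| * ‖pt v 1‖ := by
        conv_lhs => rw [e]
        refine (norm_sub_le _ _).trans ?_
        rw [norm_smul, Real.norm_eq_abs]
    _ ≤ ‖l • pt v 1 - pt w 1‖ + ‖l • pt v 1 - pt w 1‖ * ‖pt v 1‖ := by gcongr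
    _ = (1 + ‖pt v 1‖) * ‖l • pt v 1 - pt w 1‖ := by ring
    _ ≤ _ := by gcongr

/-- On the unit cube, a line determines its two marked points in a Lipschitz way. -/
theorem exists_abs_sub_le_dist_lineThrough (m : ℕ) : ∃ C : ℝ, 0 < C ∧
    ∀ a b a' b' : Fin m → ℝ, (∀ i, a i ∈ Icc (0 : ℝ) 1) → (∀ i, b i ∈ Icc (0 : ℝ) 1) →
      (∀ i, a' i ∈ Icc (0 : ℝ) 1) → (∀ i, b' i ∈ Icc (0 : ℝ) 1) → ∀ i,
        |a i - a' i| ≤ C * dist (lineThrough a b) (lineThrough a' b') ∧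
        |b i - b' i| ≤ C * dist (lineThrough a b) (lineThrough a' b') := by
  obtain ⟨R, hR⟩ : ∃ R : ℝ, R = (m + 1) * 1 := ⟨_, rfl⟩
  have hR0 : 0 < R := by rw [hR]; positivity
  refine ⟨1 + R + 2 * R * ((1 + R) * R) + (1 + R) * R, by positivity, ?_⟩
  intro a b a' b' ha hb ha' hb'
  set D := dist (lineThrough a b) (lineThrough a' b') with hD
  have hD0 : 0 ≤ D := dist_nonneg
  have hD' : D = ‖(Submodule.span ℝ {pt (b - a) 1}).starProjection
      - (Submodule.span ℝ {pt (b' - a') 1}).starProjection‖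
      + ‖(lineThrough a b).translation - (lineThrough a' b').translation‖ :=
    dist_lineThrough a b a' b'
  have hnv : ∀ {a b : Fin m → ℝ}, (∀ i, a i ∈ Icc (0 : ℝ) 1) → (∀ i, b i ∈ Icc (0 : ℝ) 1) →
      ‖pt (b - a) 1‖ ≤ R := by
    intro a b ha hb
    rw [hR]
    refine norm_pt_le (fun i => ?_) (by simp)
    rw [Pi.sub_apply, abs_le]
    constructor <;> linarith [(ha i).1, (ha i).2, (hb i).1, (hb i).2]
  have hv := hnv ha hb
  have hv' := hnv ha' hb'
  have hp' : ‖pt a' 0‖ ≤ R := by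
    rw [hR]
    refine norm_pt_le (fun i => ?_) (by simp)
    rw [abs_of_nonneg (ha' i).1]
    exact (ha' i).2
  have hvv : ‖pt (b - a) 1 - pt (b' - a') 1‖ ≤ (1 + R) * R * D := by
    refine (norm_pt_sub_pt_le _ _).trans ?_
    have h1 : ‖(Submodule.span ℝ {pt (b - a) 1}).starProjection
      - (Submodule.span ℝ {pt (b' - a') 1}).starProjection‖ ≤ D := by
      rw [hD']
      linarith [norm_nonneg ((lineThrough a b).translation - (lineThrough a' b').translation)]
    calc _ ≤ (1 + R) * (D * R) := by gcongr
      _ = _ := by ring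
  have hff : ‖(lineThrough a b).translation - (lineThrough a' b').translation‖ ≤ D := by
    rw [hD']
    linarith [norm_nonneg ((Submodule.span ℝ {pt (b - a) 1}).starProjection
      - (Submodule.span ℝ {pt (b' - a') 1}).starProjection)]
  -- The marked point is recovered from the translation `f` and the direction vector `v` as
  -- `f - f 0 • v`.
  have hrec : ∀ a b : Fin m → ℝ, pt a 0
      = (lineThrough a b).translation - (lineThrough a b).translation 0 • pt (b - a) 1 := by
    intro a b
    have h1 := (lineThrough a b).translation_mem
    change _ ∈ AffineSubspace.mk' _ _ at h1
    rw [AffineSubspace.mem_mk', vsub_eq_sub] at h1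
    obtain ⟨l, hl⟩ := Submodule.mem_span_singleton.1 h1
    have h2 : (lineThrough a b).translation = pt a 0 + l • pt (b - a) 1 := by
      rw [hl]
      abel
    have h3 : (lineThrough a b).translation 0 = l := by
      rw [h2]
      simp
    rw [h3, h2]
    abel
  have hf' : |(lineThrough a' b').translation 0| ≤ 2 * R := by
    refine (PiLp.norm_apply_le (lineThrough a' b').translation 0).trans ?_
    rw [translation_lineThrough]
    refine (norm_sub_le _ _).trans ?_
    have := Submodule.norm_starProjection_apply_le (lineThrough a' b').direction (pt a' 0)
    linarith
  have hf0 : |(lineThrough a b).translation 0 - (lineThrough a' b').translation 0| ≤ D :=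
    (PiLp.norm_apply_le ((lineThrough a b).translation - (lineThrough a' b').translation) 0).trans
      hff
  have hpp : ‖pt a 0 - pt a' 0‖ ≤ (1 + R + 2 * R * ((1 + R) * R)) * D := by
    have e : pt a 0 - pt a' 0
        = ((lineThrough a b).translation - (lineThrough a' b').translation)
          - ((lineThrough a b).translation 0 - (lineThrough a' b').translation 0) • pt (b - a) 1
          - (lineThrough a' b').translation 0 • (pt (b - a) 1 - pt (b' - a') 1) := by
      rw [hrec a b, hrec a' b', sub_smul, smul_sub]
      abel
    rw [e]
    refine (norm_sub_le _ _).trans ?_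
    refine (add_le_add_left (norm_sub_le _ _) _).trans ?_
    rw [norm_smul, norm_smul, Real.norm_eq_abs, Real.norm_eq_abs]
    have h1 := mul_le_mul hf0 hv (norm_nonneg _) hD0
    have h2 := mul_le_mul hf' hvv (norm_nonneg _) (by positivity)
    linarith
  intro i
  have h1 : |a i - a' i| ≤ ‖pt a 0 - pt a' 0‖ := by
    rw [pt_sub]
    exact abs_le_norm_pt (a - a') _ i
  have h2 : |(b i - a i) - (b' i - a' i)| ≤ ‖pt (b - a) 1 - pt (b' - a') 1‖ := by
    rw [pt_sub]
    exact abs_le_norm_pt ((b - a) - (b' - a')) _ i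
  have h3 : 0 ≤ (1 + R) * R * D := by positivity
  constructor
  · linarith
  · have e : b i - b' i = ((b i - a i) - (b' i - a' i)) + (a i - a' i) := by ring
    rw [e]
    linarith [abs_add_le ((b i - a i) - (b' i - a' i)) (a i - a' i)]

end Lines

/-! ### The union of the marked subsets of the lines -/

/-- The points `(y, (1 - y) a + y b)` with `y` in a digit set and `a`, `b` in a power of another
digit set, that is, the points with first coordinate `y` of the lines through `(0, a)` and
`(1, b)`. -/
def lineUnion (m : ℕ) (L M : ℕ → ℕ) : Set (EuclideanSpace ℝ (Fin (m + 1))) :=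
  (fun z : (Fin m → ℝ) × (Fin m → ℝ) × ℝ => pt (z.1 + z.2.2 • (z.2.1 - z.1)) z.2.2) ''
    ((univ.pi fun _ => digitSet L) ×ˢ (univ.pi fun _ => digitSet L) ×ˢ digitSet M)

theorem continuous_pt {m : ℕ} {Z : Type*} [TopologicalSpace Z] {a : Z → Fin m → ℝ} {y : Z → ℝ}
    (ha : Continuous a) (hy : Continuous y) : Continuous fun z => pt (a z) (y z) := by
  refine (PiLp.continuous_toLp 2 _).comp (continuous_pi fun i => ?_)
  refine Fin.cases hy (fun i => ?_) i
  exact (continuous_apply i).comp ha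

theorem digitCount_eq_of_idle {L : ℕ → ℕ} {q n : ℕ} (hqn : q ≤ n)
    (h : ∀ j, q ≤ j → j < n → L j = 0) : digitCount L n = digitCount L q := by
  rw [digitCount, digitCount, ← Finset.prod_range_mul_prod_Ico _ hqn]
  rw [Finset.prod_eq_one (s := Finset.Ico q n), mul_one]
  intro j hj
  rw [Finset.mem_Ico] at hj
  rw [h j hj.1 hj.2, zero_add]

theorem digitSum_eq_of_idle {x : ℕ → ℕ} {q n : ℕ} (hqn : q ≤ n)
    (h : ∀ j, q ≤ j → j < n → x j = 0) : digitSum n x = digitSum q x := by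
  rw [digitSum, digitSum, ← Finset.sum_range_add_sum_Ico _ hqn]
  rw [Finset.sum_eq_zero (s := Finset.Ico q n), add_zero]
  intro j hj
  rw [Finset.mem_Ico] at hj
  rw [h j hj.1 hj.2]
  simp

section LineUnion

variable {m : ℕ} {L M : ℕ → ℕ}

theorem isCompact_lineUnion (hL : ∀ j, L j < 2 ^ (2 * j + 1)) (hM : ∀ j, M j < 2 ^ (2 * j + 1)) :
    IsCompact (lineUnion m L M) := by
  refine ((isCompact_univ_pi fun _ => isCompact_digitSet hL).prod
    ((isCompact_univ_pi fun _ => isCompact_digitSet hL).prod (isCompact_digitSet hM))).image ?_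
  refine continuous_pt ?_ (by fun_prop)
  fun_prop

theorem digitSum_mem_Icc (hL : ∀ j, L j < 2 ^ (2 * j + 1)) {x : ℕ → ℕ} (hx : ∀ j, x j ≤ L j)
    (n : ℕ) : digitSum n x ∈ Icc (0 : ℝ) 1 :=
  ⟨Finset.sum_nonneg fun _ _ => by positivity, (digitSum_le_digitVal (digit_lt hL hx) n).trans
    (digitSet_subset_Icc hL ⟨x, hx, rfl⟩).2⟩

/-- Replacing digit expansions by their truncations at the place `n` moves the points of
`lineUnion m L M` by a bounded multiple of `2 ^ (-n ^ 2)`. -/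
theorem dist_pt_digitVal_digitSum_le (hL : ∀ j, L j < 2 ^ (2 * j + 1))
    (hM : ∀ j, M j < 2 ^ (2 * j + 1)) {x x' : Fin m → ℕ → ℕ} {u : ℕ → ℕ}
    (hx : ∀ i j, x i j ≤ L j) (hx' : ∀ i j, x' i j ≤ L j) (hu : ∀ j, u j ≤ M j) (n : ℕ) :
    dist (pt (fun i => digitVal (x i) + digitVal u * (digitVal (x' i) - digitVal (x i)))
        (digitVal u))
      (pt (fun i => digitSum n (x i) + digitSum n u * (digitSum n (x' i) - digitSum n (x i)))
        (digitSum n u)) ≤ (m + 1) * (2 * (1 / 2 ^ (n ^ 2))) := by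
  have hη : (0 : ℝ) < 1 / 2 ^ (n ^ 2) := by positivity
  have hy := dist_digitVal_digitSum_le (digit_lt hM hu) n
  have hy01 := digitSet_subset_Icc hM ⟨u, hu, rfl⟩
  rw [Real.dist_eq] at hy
  refine dist_pt_le (fun i => ?_) (by linarith)
  have ha := dist_digitVal_digitSum_le (digit_lt hL (hx i)) n
  have hb := dist_digitVal_digitSum_le (digit_lt hL (hx' i)) n
  have ha01 := digitSum_mem_Icc hL (hx i) n
  have hb01 := digitSum_mem_Icc hL (hx' i) n
  rw [Real.dist_eq] at ha hb
  generalize (1 : ℝ) / 2 ^ (n ^ 2) = η at *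
  generalize digitVal (x i) = a at *
  generalize digitVal (x' i) = b at *
  generalize digitVal u = y at *
  generalize digitSum n (x i) = a' at *
  generalize digitSum n (x' i) = b' at *
  generalize digitSum n u = y' at *
  have e : a + y * (b - a) - (a' + y' * (b' - a'))
      = (1 - y) * (a - a') + y * (b - b') + (y - y') * (b' - a') := by ring
  rw [e]
  have h1 : |(1 - y) * (a - a')| ≤ (1 - y) * η := by
    rw [abs_mul, abs_of_nonneg (by linarith [hy01.2])]
    exact mul_le_mul_of_nonneg_left ha (by linarith [hy01.2])
  have h2 : |y * (b - b')| ≤ y * η := by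
    rw [abs_mul, abs_of_nonneg hy01.1]
    exact mul_le_mul_of_nonneg_left hb hy01.1
  have h3 : |(y - y') * (b' - a')| ≤ η * 1 := by
    rw [abs_mul]
    refine mul_le_mul hy ?_ (abs_nonneg _) hη.le
    rw [abs_le]
    constructor <;> linarith [ha01.1, ha01.2, hb01.1, hb01.2]
  have h4 := abs_add_le ((1 - y) * (a - a') + y * (b - b')) ((y - y') * (b' - a'))
  have h5 := abs_add_le ((1 - y) * (a - a')) (y * (b - b'))
  linarith

theorem exists_digits_of_mem_lineUnion {p : EuclideanSpace ℝ (Fin (m + 1))}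
    (hp : p ∈ lineUnion m L M) : ∃ (x x' : Fin m → ℕ → ℕ) (u : ℕ → ℕ), (∀ i j, x i j ≤ L j) ∧
      (∀ i j, x' i j ≤ L j) ∧ (∀ j, u j ≤ M j) ∧
      p = pt (fun i => digitVal (x i) + digitVal u * (digitVal (x' i) - digitVal (x i)))
        (digitVal u) := by
  obtain ⟨⟨a, b, y⟩, ⟨ha, hb, u, hu, rfl⟩, rfl⟩ := hp
  choose x hx hxa using fun i => ha i (mem_univ i)
  choose x' hx' hxb using fun i => hb i (mem_univ i)
  refine ⟨x, x', u, hx, hx', hu, ?_⟩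
  refine congrArg (fun c => pt c (digitVal u)) (funext fun i => ?_)
  simp only [Pi.add_apply, Pi.smul_apply, Pi.sub_apply, smul_eq_mul, hxa, hxb]

/-- The covering bound counting all triples of truncated expansions. -/
theorem coveredBy_lineUnion (hL : ∀ j, L j < 2 ^ (2 * j + 1)) (hM : ∀ j, M j < 2 ^ (2 * j + 1))
    (n : ℕ) : CoveredBy (4 * (m + 1) / 2 ^ (n ^ 2))
      (digitCount L n ^ m * (digitCount L n ^ m * digitCount M n)) (lineUnion m L M) := by
  have h := coveredBy_of_net (r := (m + 1) * (2 * (1 / 2 ^ (n ^ 2)))) (X := lineUnion m L M)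
    (I := (Fin m → ∀ j : Finset.range n, Fin (L j + 1)) ×
      (Fin m → ∀ j : Finset.range n, Fin (L j + 1)) × (∀ j : Finset.range n, Fin (M j + 1)))
    (fun t => pt (fun i => digitSum n (spliceDigits L 0 (t.1 i)) +
        digitSum n (spliceDigits M 0 t.2.2) *
          (digitSum n (spliceDigits L 0 (t.2.1 i)) - digitSum n (spliceDigits L 0 (t.1 i))))
      (digitSum n (spliceDigits M 0 t.2.2))) ?_
  · rw [Fintype.card_prod, Fintype.card_prod, Fintype.card_fun, card_digits, card_digits,
      Fintype.card_fin] at h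
    refine h.mono (le_of_eq ?_) subset_rfl
    ring
  · intro p hp
    obtain ⟨x, x', u, hx, hx', hu, rfl⟩ := exists_digits_of_mem_lineUnion hp
    choose t ht using fun i => exists_digitSum_spliceDigits (hx i) n
    choose t' ht' using fun i => exists_digitSum_spliceDigits (hx' i) n
    obtain ⟨w, hw⟩ := exists_digitSum_spliceDigits hu n
    refine ⟨(t, t', w), ?_⟩
    simp only [ht, ht', hw]
    exact dist_pt_digitVal_digitSum_le hL hM hx hx' hu n

/-- The covering bound at a place `n` such that the first coordinate has no digits from `q` to `n`.
The truncated first coordinate is then `Y / 2 ^ (q ^ 2)` for an integer `Y`, and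
`(2 ^ (q ^ 2) - Y) x + Y x'` is a digit sequence with digits at most `2 ^ (q ^ 2) * L j`, so that
`n * q ^ 2` extra binary digits account for the second expansion. -/
theorem coveredBy_lineUnion_of_idle (hL : ∀ j, L j < 2 ^ (2 * j + 1))
    (hM : ∀ j, M j < 2 ^ (2 * j + 1)) {q n : ℕ} (hqn : q ≤ n)
    (hidle : ∀ j, q ≤ j → j < n → M j = 0) :
    CoveredBy (4 * (m + 1) / 2 ^ (n ^ 2))
      (digitCount (fun j => 2 ^ (q ^ 2) * L j) n ^ m * digitCount M n) (lineUnion m L M) := by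
  have h := coveredBy_of_net (r := (m + 1) * (2 * (1 / 2 ^ (n ^ 2)))) (X := lineUnion m L M)
    (I := (Fin m → ∀ j : Finset.range n, Fin (2 ^ (q ^ 2) * L j + 1)) ×
      (∀ j : Finset.range n, Fin (M j + 1)))
    (fun t => pt (fun i =>
        digitSum n (spliceDigits (fun j => 2 ^ (q ^ 2) * L j) 0 (t.1 i)) / 2 ^ (q ^ 2))
      (digitSum n (spliceDigits M 0 t.2))) ?_
  · rw [Fintype.card_prod, Fintype.card_fun, card_digits (L := fun j => 2 ^ (q ^ 2) * L j),
      card_digits, Fintype.card_fin] at h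
    refine h.mono (le_of_eq ?_) subset_rfl
    ring
  · intro p hp
    obtain ⟨x, x', u, hx, hx', hu, rfl⟩ := exists_digits_of_mem_lineUnion hp
    obtain ⟨w, hw⟩ := exists_digitSum_spliceDigits hu n
    have hY : digitSum n u = digitNum u q / 2 ^ (q ^ 2) := by
      rw [digitSum_eq_of_idle hqn fun j h1 h2 => Nat.le_zero.1 ((hu j).trans (hidle j h1 h2).le),
        digitSum_eq]
    set Y := digitNum u q
    have hYle : Y ≤ 2 ^ (q ^ 2) := by
      have h1 := (digitSum_mem_Icc hM hu n).2
      rw [hY, div_le_one (by positivity)] at h1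
      exact_mod_cast h1
    have hz : ∀ i j, (2 ^ (q ^ 2) - Y) * x i j + Y * x' i j ≤ 2 ^ (q ^ 2) * L j := by
      intro i j
      calc _ ≤ (2 ^ (q ^ 2) - Y) * L j + Y * L j :=
            Nat.add_le_add (Nat.mul_le_mul_left _ (hx i j)) (Nat.mul_le_mul_left _ (hx' i j))
        _ = _ := by rw [← Nat.add_mul, Nat.sub_add_cancel hYle]
    choose t ht using fun i =>
      exists_digitSum_spliceDigits (L := fun j => 2 ^ (q ^ 2) * L j) (hz i) n
    refine ⟨(t, w), ?_⟩
    simp only [ht, hw]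
    refine le_of_eq_of_le (congrArg (fun c => dist _ (pt c (digitSum n u))) (funext fun i => ?_))
      (dist_pt_digitVal_digitSum_le hL hM hx hx' hu n)
    have hlin : digitSum n (fun j => (2 ^ (q ^ 2) - Y) * x i j + Y * x' i j)
        = (2 ^ (q ^ 2) - Y) * digitSum n (x i) + Y * digitSum n (x' i) := by
      simp only [digitSum, Finset.mul_sum, ← Finset.sum_add_distrib]
      refine Finset.sum_congr rfl fun j _ => ?_
      push_cast [Nat.cast_sub hYle]
      ring
    rw [hlin, hY]
    field_simp
    ring

theorem upperBoxDim_lineUnion_le {α s : ℝ} (hα : 0 ≤ α)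
    (hL : ∀ j, L j < 2 ^ (2 * j + 1)) (hM : ∀ j, M j < 2 ^ (2 * j + 1))
    (hLcount : ∀ n : ℕ, (digitCount L n : ℝ) ≤ 2 ^ (α * (n : ℝ) ^ 2))
    (hMcount : ∀ n : ℕ, (digitCount M n : ℝ) ≤ 2 ^ (s * (n : ℝ) ^ 2))
    (hidle : ∀ n : ℕ, ∃ q : ℕ, q ^ 4 ≤ n ∧
      ((∀ j, q ≤ j → j < n → L j = 0) ∨ ∀ j, q ≤ j → j < n → M j = 0)) :
    upperBoxDim (lineUnion m L M) ≤ ((max s (m * α) : ℝ) : EReal) := by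
  refine upperBoxDim_le_of_square_scales (C := 4 * (m + 1)) (le_max_of_le_right (by positivity))
    (by positivity) fun ε hε => ?_
  filter_upwards [eventually_ge_atTop 1, (tendsto_natCast_atTop_atTop (R := ℝ)).eventually_ge_atTop
    (((2 * m + 1) / ε) ^ 2)] with n hn1 hnε
  obtain ⟨q, hq, hcases⟩ := hidle n
  have hqn : q ≤ n := (Nat.le_self_pow (by norm_num) q).trans hq
  have hn1' : (1 : ℝ) ≤ n := by exact_mod_cast hn1
  have hsmall : (2 * m + 1) * (q : ℝ) ^ 2 ≤ ε * n := by
    refine (sq_le_sq₀ (by positivity) (by positivity)).1 ?_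
    have h1 : (q : ℝ) ^ 4 ≤ n := by exact_mod_cast hq
    rw [div_pow, div_le_iff₀ (by positivity)] at hnε
    calc ((2 * m + 1) * (q : ℝ) ^ 2) ^ 2 = (2 * m + 1) ^ 2 * (q : ℝ) ^ 4 := by ring
      _ ≤ (n * ε ^ 2) * n := by gcongr
      _ = (ε * n) ^ 2 := by ring
  have hq2 : (q : ℝ) ^ 2 ≤ q ^ 2 * n := le_mul_of_one_le_right (by positivity) hn1'
  have hm : (0 : ℝ) ≤ m := Nat.cast_nonneg m
  have key : ∀ e : ℝ, e ≤ max s (m * α) * (n : ℝ) ^ 2 + (2 * m + 1) * (q ^ 2 * n) →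
      (2 : ℝ) ^ e ≤ 2 ^ ((max s (m * α) + ε) * (n : ℝ) ^ 2) := by
    intro e he
    refine Real.rpow_le_rpow_of_exponent_le one_le_two (he.trans ?_)
    nlinarith
  have hcq : ∀ {K : ℕ → ℕ}, (∀ j, K j < 2 ^ (2 * j + 1)) → (∀ j, q ≤ j → j < n → K j = 0) →
      (digitCount K n : ℝ) ≤ 2 ^ ((q : ℝ) ^ 2) := by
    intro K hK hK0
    rw [digitCount_eq_of_idle hqn hK0, ← Nat.cast_pow, Real.rpow_natCast]
    exact_mod_cast digitCount_le hK q
  rcases hcases with h0 | h0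
  · refine ⟨_, coveredBy_lineUnion hL hM n, ?_⟩
    push_cast
    calc (digitCount L n : ℝ) ^ m * (digitCount L n ^ m * digitCount M n)
        ≤ (2 ^ ((q : ℝ) ^ 2)) ^ m * ((2 ^ ((q : ℝ) ^ 2)) ^ m * 2 ^ (s * (n : ℝ) ^ 2)) := by
          gcongr
          · exact hcq hL h0
          · exact hcq hL h0
          · exact hMcount n
      _ = 2 ^ (2 * m * (q : ℝ) ^ 2 + s * (n : ℝ) ^ 2) := by
          rw [← Real.rpow_mul_natCast two_pos.le, ← Real.rpow_add two_pos, ← Real.rpow_add two_pos]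
          congr 1
          ring
      _ ≤ _ := by
          refine key _ ?_
          have h1 : s * (n : ℝ) ^ 2 ≤ max s (m * α) * (n : ℝ) ^ 2 := by
            gcongr
            exact le_max_left _ _
          have h2 : 2 * m * (q : ℝ) ^ 2 ≤ 2 * m * (q ^ 2 * n) := by gcongr
          linarith [sq_nonneg (q : ℝ)]
  · refine ⟨_, coveredBy_lineUnion_of_idle hL hM hqn h0, ?_⟩
    have hW : (digitCount (fun j => 2 ^ (q ^ 2) * L j) n : ℝ)
        ≤ 2 ^ ((q : ℝ) ^ 2 * n) * 2 ^ (α * (n : ℝ) ^ 2) := by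
      have h1 : digitCount (fun j => 2 ^ (q ^ 2) * L j) n
          ≤ (2 ^ (q ^ 2)) ^ n * digitCount L n := by
        have h2 : (2 ^ (q ^ 2)) ^ n * digitCount L n
            = ∏ j ∈ Finset.range n, 2 ^ (q ^ 2) * (L j + 1) := by
          rw [Finset.prod_mul_distrib, Finset.prod_const, Finset.card_range, digitCount]
        rw [h2]
        refine Finset.prod_le_prod' fun j _ => ?_
        have : 1 ≤ 2 ^ (q ^ 2) := Nat.one_le_two_pow
        rw [mul_add, mul_one]
        exact Nat.add_le_add_left this _
      have h3 : (digitCount (fun j => 2 ^ (q ^ 2) * L j) n : ℝ)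
          ≤ (2 ^ (q ^ 2)) ^ n * digitCount L n := by exact_mod_cast h1
      refine h3.trans ?_
      rw [Real.rpow_mul_natCast two_pos.le, ← Nat.cast_pow, Real.rpow_natCast]
      gcongr
      exact hLcount n
    push_cast
    calc (digitCount (fun j => 2 ^ (q ^ 2) * L j) n : ℝ) ^ m * digitCount M n
        ≤ (2 ^ ((q : ℝ) ^ 2 * n) * 2 ^ (α * (n : ℝ) ^ 2)) ^ m * 2 ^ ((q : ℝ) ^ 2) := by
          gcongr
          exact hcq hM h0
      _ = 2 ^ (m * (q ^ 2 * n) + m * α * (n : ℝ) ^ 2 + (q : ℝ) ^ 2) := by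
          rw [← Real.rpow_add two_pos, ← Real.rpow_mul_natCast two_pos.le, ← Real.rpow_add two_pos]
          congr 1
          ring
      _ ≤ _ := by
          refine key _ ?_
          have h1 : m * α * (n : ℝ) ^ 2 ≤ max s (m * α) * (n : ℝ) ^ 2 := by
            gcongr
            exact le_max_right _ _
          have h2 : 0 ≤ m * ((q : ℝ) ^ 2 * n) := by positivity
          linarith

/-! ### Dimensions of the lines and of their intersections -/

theorem pt_mem_lineUnion {a b : Fin m → ℝ} {y : ℝ} (ha : ∀ i, a i ∈ digitSet L)
    (hb : ∀ i, b i ∈ digitSet L) (hy : y ∈ digitSet M) :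
    pt (a + y • (b - a)) y ∈ lineUnion m L M :=
  ⟨(a, b, y), ⟨fun i _ => ha i, fun i _ => hb i, hy⟩, rfl⟩

theorem packingDim_le_packingDim_inter {a b : Fin m → ℝ} (ha : ∀ i, a i ∈ digitSet L)
    (hb : ∀ i, b i ∈ digitSet L) :
    packingDim (univ.pi fun _ : Unit => digitSet M)
      ≤ packingDim ((lineThrough a b).points ∩ lineUnion m L M) := by
  have hne : (univ.pi fun _ : Unit => digitSet M).Nonempty :=
    ⟨fun _ => 0, fun _ _ => zero_mem_digitSet⟩
  refine (packingDim_le_packingDim_image (K := 1)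
    (f := fun y : Unit → ℝ => pt (a + y () • (b - a)) (y ()))
    hne one_pos fun y _ z _ => ?_).trans
    (packingDim_mono ?_)
  · rw [one_mul]
    refine (dist_pi_le_iff dist_nonneg).2 fun i => ?_
    rw [dist_eq_norm (pt _ _), pt_sub, Real.dist_eq]
    exact abs_le_norm_pt' _ _
  · rintro _ ⟨y, hy, rfl⟩
    exact ⟨pt_mem_points_lineThrough a b _, pt_mem_lineUnion ha hb (hy () (mem_univ _))⟩

theorem packingDim_le_packingDim_lineUnion :
    packingDim (univ.pi fun _ : Fin m => digitSet L) ≤ packingDim (lineUnion m L M) := by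
  have hne : (univ.pi fun _ : Fin m => digitSet L).Nonempty :=
    ⟨fun _ => 0, fun _ _ => zero_mem_digitSet⟩
  refine (packingDim_le_packingDim_image (K := 1) (f := fun a : Fin m → ℝ => pt a 0)
    hne one_pos fun y _ z _ => ?_).trans
    (packingDim_mono ?_)
  · rw [one_mul]
    refine (dist_pi_le_iff dist_nonneg).2 fun i => ?_
    rw [dist_eq_norm (pt _ _), pt_sub, Real.dist_eq]
    exact abs_le_norm_pt (y - z) _ i
  · rintro _ ⟨a, ha, rfl⟩
    have := pt_mem_lineUnion (M := M) (fun i => ha i (mem_univ i)) (fun i => ha i (mem_univ i))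
      zero_mem_digitSet
    simpa using this

/-- The lines joining the points `(0, a)` and `(1, b)`, where `a` and `b` have coordinates in a
digit set. -/
def lineFamily (m : ℕ) (L : ℕ → ℕ) : Set (AffineLine (m + 1)) :=
  (fun c : Fin m ⊕ Fin m → ℝ => lineThrough (fun i => c (Sum.inl i)) fun i => c (Sum.inr i)) ''
    (univ.pi fun _ => digitSet L)

theorem packingDim_le_packingDim_lineFamily (hL : ∀ j, L j < 2 ^ (2 * j + 1)) :
    packingDim (univ.pi fun _ : Fin m ⊕ Fin m => digitSet L) ≤ packingDim (lineFamily m L) := by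
  obtain ⟨C, hC, h⟩ := exists_abs_sub_le_dist_lineThrough m
  have hI : ∀ {c : Fin m ⊕ Fin m → ℝ}, c ∈ (univ.pi fun _ => digitSet L) →
      ∀ i, c i ∈ Icc (0 : ℝ) 1 := fun hc i => digitSet_subset_Icc hL (hc i (mem_univ i))
  refine packingDim_le_packingDim_image ⟨fun _ => 0, fun _ _ => zero_mem_digitSet⟩ hC
    fun c hc c' hc' => ?_
  have key := h _ _ _ _ (fun i => hI hc (Sum.inl i)) (fun i => hI hc (Sum.inr i))
    (fun i => hI hc' (Sum.inl i)) (fun i => hI hc' (Sum.inr i))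
  refine (dist_pi_le_iff (by positivity)).2 fun i => ?_
  rw [Real.dist_eq]
  rcases i with i | i
  · exact (key i).1
  · exact (key i).2

theorem packingDim_lineFamily_le (hL : ∀ j, L j < 2 ^ (2 * j + 1)) :
    packingDim (lineFamily m L) ≤ upperBoxDim (univ.pi fun _ : Fin m ⊕ Fin m => digitSet L) := by
  set C : ℝ := (m + 2) * (8 * (m + 1)) + 2 * (m + 1) with hC
  have hC0 : 0 < C := by positivity
  have hlip : ∀ c ∈ (univ.pi fun _ : Fin m ⊕ Fin m => digitSet L),
      ∀ c' ∈ (univ.pi fun _ : Fin m ⊕ Fin m => digitSet L),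
      dist (lineThrough (fun i => c (Sum.inl i)) fun i => c (Sum.inr i))
        (lineThrough (fun i => c' (Sum.inl i)) fun i => c' (Sum.inr i)) ≤ C * dist c c' := by
    intro c hc c' hc'
    refine dist_lineThrough_le dist_nonneg (fun i => ?_) (fun i => ?_) fun i => ?_
    · have := digitSet_subset_Icc hL (hc' (Sum.inl i) (mem_univ _))
      rw [abs_of_nonneg this.1]
      exact this.2
    · exact dist_le_pi_dist c c' (Sum.inl i)
    · exact dist_le_pi_dist c c' (Sum.inr i)
  refine (packingDim_le_upperBoxDim ?_).trans (upperBoxDim_image_le hC0 hlip)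
  obtain ⟨B, hB⟩ := Metric.isBounded_iff.1 (isBounded_pi_digitSet (ι := Fin m ⊕ Fin m) hL)
  refine Metric.isBounded_iff.2 ⟨C * B, ?_⟩
  rintro _ ⟨c, hc, rfl⟩ _ ⟨c', hc', rfl⟩
  exact (hlip c hc c' hc').trans (mul_le_mul_of_nonneg_left (hB hc hc') hC0.le)

end LineUnion

theorem theorem4 (d : ℕ) (hd : 2 ≤ d) (s t : ℝ) (hs : 0 ≤ s ∧ s ≤ 1)
    (ht : 0 ≤ t ∧ t ≤ 2 * ((d : ℝ) - 1)) :
    ∃ (X : Set (EuclideanSpace ℝ (Fin d))) (𝓛 : Set (AffineLine d)),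
      IsCompact X ∧
      packingDim X = ((max s (t / 2) : ℝ) : EReal) ∧
      𝓛.Nonempty ∧
      packingDim 𝓛 = (t : EReal) ∧
      ∀ L ∈ 𝓛, (L.points ∩ X).Nonempty ∧ (s : EReal) ≤ packingDim (L.points ∩ X) := by
  obtain ⟨m, rfl⟩ : ∃ m, d = m + 1 := ⟨d - 1, by omega⟩
  have hm : (0 : ℝ) < m := by
    have : 0 < m := by omega
    exact_mod_cast this
  obtain ⟨α, rfl⟩ : ∃ α, t = 2 * (m * α) := ⟨t / (2 * m), by field_simp⟩
  have hα : 0 ≤ α := by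
    by_contra! h
    nlinarith [mul_pos_of_neg_of_neg (neg_neg_of_pos hm) h]
  have hα1 : α ≤ 1 := by
    have := ht.2
    push_cast at this
    by_contra! h
    nlinarith [mul_lt_mul_of_pos_left h hm]
  have hhalf : 2 * (m * α) / 2 = m * α := by ring
  rw [hhalf]
  have hcard : (Fintype.card (Fin m ⊕ Fin m) : ℝ) * α = 2 * (m * α) := by
    rw [Fintype.card_sum, Fintype.card_fin]
    push_cast
    ring
  set L := phaseBound 0 α
  set M := phaseBound 2 s
  have hL : ∀ j, L j < 2 ^ (2 * j + 1) := phaseBound_lt hα hα1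
  have hM : ∀ j, M j < 2 ^ (2 * j + 1) := phaseBound_lt hs.1 hs.2
  have hidle : ∀ n : ℕ, ∃ q : ℕ, q ^ 4 ≤ n ∧
      ((∀ j, q ≤ j → j < n → L j = 0) ∨ ∀ j, q ≤ j → j < n → M j = 0) := by
    intro n
    obtain ⟨q, hq, h⟩ := exists_idle_range n
    exact ⟨q, hq, h.imp (fun h j h1 h2 => if_neg (h j h1 h2)) fun h j h1 h2 => if_neg (h j h1 h2)⟩
  have hinter : ∀ ℓ ∈ lineFamily m L, (s : EReal) ≤ packingDim (ℓ.points ∩ lineUnion m L M) := by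
    rintro _ ⟨c, hc, rfl⟩
    have h := packingDim_le_packingDim_inter (M := M) (fun i => hc (Sum.inl i) (mem_univ _))
      (fun i => hc (Sum.inr i) (mem_univ _))
    rw [packingDim_pi_digitSet_phaseBound (by norm_num) hs.1 hs.2] at h
    simpa using h
  have hne : (lineFamily m L).Nonempty :=
    ⟨_, fun _ => 0, fun _ _ => zero_mem_digitSet, rfl⟩
  refine ⟨lineUnion m L M, lineFamily m L, isCompact_lineUnion hL hM, le_antisymm ?_ ?_, hne,
    le_antisymm ?_ ?_, fun ℓ hℓ => ⟨?_, hinter ℓ hℓ⟩⟩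
  · exact (packingDim_le_upperBoxDim (isCompact_lineUnion hL hM).isBounded).trans
      (upperBoxDim_lineUnion_le hα hL hM (digitCount_phaseBound_le hα)
        (digitCount_phaseBound_le hs.1) hidle)
  · rw [EReal.coe_strictMono.monotone.map_max]
    refine max_le ?_ ?_
    · obtain ⟨ℓ, hℓ⟩ := hne
      exact (hinter ℓ hℓ).trans (packingDim_mono inter_subset_right)
    · have h := packingDim_le_packingDim_lineUnion (m := m) (L := L) (M := M)
      rwa [packingDim_pi_digitSet_phaseBound (by norm_num) hα hα1, Fintype.card_fin] at h
  · refine (packingDim_lineFamily_le hL).trans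
      ((upperBoxDim_pi_digitSet_le hL hα (digitCount_phaseBound_le hα)).trans (le_of_eq ?_))
    rw [hcard]
  · refine le_trans (le_of_eq ?_) (packingDim_le_packingDim_lineFamily hL)
    rw [packingDim_pi_digitSet_phaseBound (by norm_num) hα hα1, hcard]
  · obtain ⟨c, hc, rfl⟩ := hℓ
    exact ⟨_, pt_mem_points_lineThrough _ _ 0, pt_mem_lineUnion (fun i => hc _ (mem_univ _))
      (fun i => hc _ (mem_univ _)) zero_mem_digitSet⟩
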